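/- **Setting.** A cell-free massive MIMO system has $M$ access points (APs) with $L$ antennas each, $K$ single-antenna users, bandwidth $B\ge 0$, and pilot signals $\varphi_1,\dots,\varphi_{\tau_p}\in\mathbb{C}^{\tau_p}$ that are orthonormal. The pilot assignment is $p_{kt}\in\{0,1\}$ with $\sum_{t}p_{kt}=1$ for every user $k$. Let $\beta_{mk}>0$ be the large-scale fading coefficients, $\eta_{mk}\ge 0$ the power-control coefficients, and $\rho_p,\rho_d\ge 0$ the normalized pilot and downlink powers. The channels $\mathbf g_{mk}\in\mathbb{C}^L$ have entries distributed as $\mathcal{CN}(0,\beta_{mk})$, the pilot-phase noises $\mathbf W_m\in\mathbb{C}^{L\times\tau_p}$ have entries distributed as $\mathcal{CN}(0,1)$, the receiver noises $w_k$ are $\mathcal{CN}(0,1)$, and the data symbols $q_k$ satisfy $\mathbb{E}q_k=0$, $\mathbb{E}|q_k|^2=1$; all these scalar random variables are mutually independent. AP $m$ receives in the pilot phase $$\mathbf Y_m=\sqrt{\tau_p\rho_p}\sum_{k=1}^K\sum_{t=1}^{\tau_p}p_{kt}\,\mathbf g_{mk}\varphi_t^H+\mathbf W_m ,$$ and forms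 the channel estimates $$\hat{\mathbf g}_{mk}=c_{mk}\,\mathbf Y_m\sum_{t=1}^{\tau_p}p_{kt}\varphi_t,\qquad c_{mk}=\frac{\sqrt{\tau_p\rho_p}\,\beta_{mk}}{\tau_p\rho_p\sum_{j=1}^K\sum_{t'=1}^{\tau_p}\sum_{t=1}^{\tau_p}\beta_{mj}\,|p_{jt'}\varphi_{t'}^H p_{kt}\varphi_t|+1}.$$ Put $\gamma_{mk}=\sqrt{\tau_p\rho_p}\,\beta_{mk}c_{mk}$. With conjugate beamforming AP $m$ sends $\mathbf x_m=\sqrt{\rho_d}\sum_{j=1}^K\sqrt{\eta_{mj}}\,\hat{\mathbf g}_{mj}q_j$, and user $k$ receives $$r_k=\sum_{m=1}^M\mathbf g_{mk}^H\mathbf x_m+w_k .$$ Let $a_k=\sqrt{\rho_d}\sum_{m}\sqrt{\eta_{mk}}\,\mathbf g_{mk}^H\hat{\mathbf g}_{mk}$ be the random coefficient of $q_k$ in $r_k$ and $v_k=r_k-\mathbb{E}[a_k]\,q_k$ the effective noise. The (use-and-then-forget) ergodic throughput of user $k$ is $B\log_2\!\big(1+|\mathbb{E}a_k|^2/\mathbb{E}|v_k|^2\big)$.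 The downlink capacity $C_k$ of user $k$, in bits per channel use, is the supremum of the mutual information between $q_k$ and $r_k$ over all laws of $q_k$ on $\mathbb{C}$ with $\mathbb{E}|q_k|^2=1$, where $q_k$ is independent of the channels, the noises and the other symbols, and the receiver observes only $r_k$. **Lemma.** For every $m,j$, each entry of $\hat{\mathbf g}_{mj}$ is a linear minimum mean square error estimate of the corresponding entry of $\mathbf g_{mj}$ from $\mathbf Y_m$, and it is square integrable with second moment $\gamma_{mj}$. For every user $k$, $a_k$ is integrable, $v_k$ is square integrable with $\mathbb{E}|v_k|^2>0$, and the ergodic throughput of user $k$ equals $$R_{dk}=B\log_2\left(1+\frac{\rho_dL^2\Big(\sum\limits_{m=1}^M\sqrt{\eta_{mk}}\,\gamma_{mk}\Big)^2}{\rho_dL^2\sum\limits_{j\ne k}\Big(\sum\limits_{m=1}^M\sqrt{\eta_{mj}}\,\gamma_{mj}\frac{\beta_{mk}}{\beta_{mj}}\Big)^2\Big|\sum\limits_{t=1}^{\tau_p}\sum\limits_{t'=1}^{\tau_p}p_{jt}\varphi_t^Hp_{kt'}\varphi_{t'}\Big|+\rho_dL\sum\limits_{j=1}^K\sum\limits_{m=1}^M\eta_{mj}\gamma_{mj}\beta_{mk}+1}\right).$$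 This throughput is achievable in the sense that $R_{dk}\le B\,C_k$. Moreover, $R_{dk}$ does not change if $\varphi_1,\dots,\varphi_{\tau_p}$ is replaced by any other orthonormal family of pilots; so, for a given system ($M,K,L,\tau_p,B,\rho_p,\rho_d$), it depends only on the large-scale fading, the power-control coefficients and the pilot assignment. -/

import Mathlib

open MeasureTheory ProbabilityTheory
open scoped ENNReal ComplexConjugate

noncomputable section

/-- The circularly symmetric complex Gaussian law `CN(0, v)`: real and imaginary parts are
independent centred real Gaussians of variance `v / 2`. -/
def complexGaussian (v : ℝ) : Measure ℂ :=
  ((gaussianReal 0 (v / 2).toNNReal).prod (gaussianReal 0 (v / 2).toNNReal)).map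
    (fun z : ℝ × ℝ => (⟨z.1, z.2⟩ : ℂ))

/-- `Xhat` is a linear minimum mean square error estimate of `X` from the finite family of
observations `Y`. -/
def IsLMMSE {Ω ι : Type*} [MeasurableSpace Ω] [Fintype ι] (P : Measure Ω)
    (X : Ω → ℂ) (Y : ι → Ω → ℂ) (Xhat : Ω → ℂ) : Prop :=
  (∃ A : ι → ℂ, ∀ ω, Xhat ω = ∑ i, A i * Y i ω) ∧
    ∀ A : ι → ℂ, ∫ ω, ‖X ω - Xhat ω‖ ^ 2 ∂P ≤ ∫ ω, ‖X ω - ∑ i, A i * Y i ω‖ ^ 2 ∂P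

/-- Mutual information (in nats) between the input `x` of law `μ` and the output `T x ω` of a
channel whose randomness `ω` has law `P` and is independent of the input: the Kullback-Leibler
divergence of the joint law from the product of the marginals. -/
def mutualInfo {Ω : Type*} [MeasurableSpace Ω] (P : Measure Ω) (T : ℂ → Ω → ℂ)
    (μ : Measure ℂ) : ℝ≥0∞ :=
  InformationTheory.klDiv
    ((μ.prod P).map (fun z : ℂ × Ω => (z.1, T z.1 z.2)))
    (μ.prod ((μ.prod P).map (fun z : ℂ × Ω => T z.1 z.2)))

/-- Capacity, in bits per channel use, under the unit power constraint `E |x| ^ 2 = 1`; the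
receiver observes the output only. -/
def channelCapacity {Ω : Type*} [MeasurableSpace Ω] (P : Measure Ω) (T : ℂ → Ω → ℂ) : ℝ≥0∞ :=
  ⨆ (μ : Measure ℂ) (_ : IsProbabilityMeasure μ) (_ : ∫ x, ‖x‖ ^ 2 ∂μ = 1),
    mutualInfo P T μ / ENNReal.ofReal (Real.log 2)

/-- The deterministic parameters of a cell-free system with `M` access points of `L` antennas
each, `K` single-antenna users and `τ` pilots of length `τ`. -/
structure CellFree (M K L τ : ℕ) where
  /-- bandwidth -/
  B : ℝ
  /-- normalized SNR of a pilot symbol -/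
  ρp : ℝ
  /-- maximum normalized downlink power of an access point -/
  ρd : ℝ
  /-- large-scale fading -/
  β : Fin M → Fin K → ℝ
  /-- power control coefficients -/
  η : Fin M → Fin K → ℝ
  /-- pilot assignment indicators -/
  p : Fin K → Fin τ → ℕ
  /-- pilot signals -/
  φ : Fin τ → EuclideanSpace ℂ (Fin τ)

/-- The random quantities: channels `g`, pilot-phase noise `W`, data symbols `q` and
downlink receiver noise `w`. -/
structure CellFreeRV (M K L τ : ℕ) (Ω : Type*) where
  g : Fin M → Fin K → Fin L → Ω → ℂ
  W : Fin M → Fin L → Fin τ → Ω → ℂ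
  q : Fin K → Ω → ℂ
  w : Fin K → Ω → ℂ

namespace CellFree

variable {M K L τ : ℕ} {Ω : Type*}

/-- Standing conditions on the parameters. -/
structure Admissible (S : CellFree M K L τ) : Prop where
  B_nonneg : 0 ≤ S.B
  ρp_nonneg : 0 ≤ S.ρp
  ρd_nonneg : 0 ≤ S.ρd
  β_pos : ∀ m k, 0 < S.β m k
  η_nonneg : ∀ m k, 0 ≤ S.η m k
  p_binary : ∀ k t, S.p k t = 0 ∨ S.p k t = 1
  p_sum : ∀ k, ∑ t, S.p k t = 1
  φ_orthonormal : Orthonormal ℂ S.φ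

/-- All random quantities `g m k l`, `W m l s`, `q k`, `w k` as one family. -/
def allRV (Z : CellFreeRV M K L τ Ω) :
    (Fin M × Fin K × Fin L) ⊕ (Fin M × Fin L × Fin τ) ⊕ Fin K ⊕ Fin K → Ω → ℂ :=
  Sum.elim (fun i => Z.g i.1 i.2.1 i.2.2)
    (Sum.elim (fun i => Z.W i.1 i.2.1 i.2.2) (Sum.elim Z.q Z.w))

/-- The probabilistic model: everything is independent, channels are `CN(0, β m k)`, noises are
`CN(0, 1)`, and data symbols are centred with unit power (of otherwise arbitrary law). -/
structure IsModel [MeasurableSpace Ω] (S : CellFree M K L τ) (P : Measure Ω)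
    (Z : CellFreeRV M K L τ Ω) : Prop where
  measurable : ∀ i, Measurable (allRV Z i)
  indep : iIndepFun (allRV Z) P
  g_law : ∀ m k l, P.map (Z.g m k l) = complexGaussian (S.β m k)
  W_law : ∀ m l s, P.map (Z.W m l s) = complexGaussian 1
  w_law : ∀ k, P.map (Z.w k) = complexGaussian 1
  q_mean : ∀ k, ∫ ω, Z.q k ω ∂P = 0
  q_power : ∀ k, ∫ ω, ‖Z.q k ω‖ ^ 2 ∂P = 1

/-- Entry `(l, s)` of the pilot-phase signal received at access point `m`,
`Y_m = √(τ ρp) ∑ₖ ∑ₜ p_kt g_mk φ_tᴴ + W_m`. -/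
def pilotRx (S : CellFree M K L τ) (Z : CellFreeRV M K L τ Ω)
    (m : Fin M) (l : Fin L) (s : Fin τ) (ω : Ω) : ℂ :=
  (√(τ * S.ρp) : ℂ) * ∑ k, ∑ t, (S.p k t : ℂ) * Z.g m k l ω * starRingEnd ℂ (S.φ t s) + Z.W m l s ω

/-- The coefficient `c_mk`. -/
def c (S : CellFree M K L τ) (m : Fin M) (k : Fin K) : ℝ :=
  √(τ * S.ρp) * S.β m k /
    (τ * S.ρp * ∑ j, ∑ t', ∑ t,
      S.β m j * ‖(S.p j t' : ℂ) * (S.p k t : ℂ) * inner ℂ (S.φ t') (S.φ t)‖ + 1)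

/-- `γ_mk = √(τ ρp) β_mk c_mk`. -/
def γ (S : CellFree M K L τ) (m : Fin M) (k : Fin K) : ℝ :=
  √(τ * S.ρp) * S.β m k * S.c m k

/-- Entry `l` of the channel estimate `ĝ_mk = c_mk Y_m ∑ₜ p_kt φ_t`. -/
def estimate (S : CellFree M K L τ) (Z : CellFreeRV M K L τ Ω)
    (m : Fin M) (k : Fin K) (l : Fin L) (ω : Ω) : ℂ :=
  (S.c m k : ℂ) * ∑ s, S.pilotRx Z m l s ω * ∑ t, (S.p k t : ℂ) * S.φ t s

/-- Entry `l` of the signal sent by access point `m` with conjugate beamforming when the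
symbols are `x`. -/
def transmit (S : CellFree M K L τ) (Z : CellFreeRV M K L τ Ω)
    (x : Fin K → ℂ) (m : Fin M) (l : Fin L) (ω : Ω) : ℂ :=
  (√S.ρd : ℂ) * ∑ j, (√(S.η m j) : ℂ) * S.estimate Z m j l ω * x j

/-- The signal received by user `k` when the symbols are `x`: `∑ₘ g_mkᴴ x_m + w_k`. -/
def received (S : CellFree M K L τ) (Z : CellFreeRV M K L τ Ω)
    (k : Fin K) (x : Fin K → ℂ) (ω : Ω) : ℂ :=
  ∑ m, ∑ l, conj (Z.g m k l ω) * S.transmit Z x m l ω + Z.w k ω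

/-- The downlink channel of user `k`: its own symbol is the input `x`, and the symbols of the
other users are interference. -/
def userChannel (S : CellFree M K L τ) (Z : CellFreeRV M K L τ Ω)
    (k : Fin K) (x : ℂ) (ω : Ω) : ℂ :=
  S.received Z k (Function.update (fun j => Z.q j ω) k x) ω

/-- The random coefficient with which user `k` receives its own symbol. -/
def gain (S : CellFree M K L τ) (Z : CellFreeRV M K L τ Ω) (k : Fin K) (ω : Ω) : ℂ :=
  (√S.ρd : ℂ) * ∑ m, (√(S.η m k) : ℂ) * ∑ l, conj (Z.g m k l ω) * S.estimate Z m k l ω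

/-- The effective noise of user `k`, which only knows the mean of its gain:
`r_k - E[gain] q_k`. -/
def effNoise [MeasurableSpace Ω] (S : CellFree M K L τ) (P : Measure Ω)
    (Z : CellFreeRV M K L τ Ω) (k : Fin K) (ω : Ω) : ℂ :=
  S.received Z k (fun j => Z.q j ω) ω - (∫ ω', S.gain Z k ω' ∂P) * Z.q k ω

/-- The use-and-then-forget ergodic throughput of user `k`. -/
def ergodicThroughput [MeasurableSpace Ω] (S : CellFree M K L τ) (P : Measure Ω)
    (Z : CellFreeRV M K L τ Ω) (k : Fin K) : ℝ :=
  S.B * Real.logb 2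
    (1 + ‖∫ ω, S.gain Z k ω ∂P‖ ^ 2 / ∫ ω, ‖S.effNoise P Z k ω‖ ^ 2 ∂P)

/-- The closed-form downlink rate. -/
def downlinkRate (S : CellFree M K L τ) (k : Fin K) : ℝ :=
  S.B * Real.logb 2 (1 +
    S.ρd * (L : ℝ) ^ 2 * (∑ m, √(S.η m k) * S.γ m k) ^ 2 /
      (S.ρd * (L : ℝ) ^ 2 * ∑ j ∈ Finset.univ.erase k,
          (∑ m, √(S.η m j) * S.γ m j * (S.β m k / S.β m j)) ^ 2 *
            ‖∑ t, ∑ t', (S.p j t : ℂ) * (S.p k t' : ℂ) * inner ℂ (S.φ t) (S.φ t')‖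
        + S.ρd * L * ∑ j, ∑ m, S.η m j * S.γ m j * S.β m k + 1))

end CellFree

end

/-! ### Moments of real and complex Gaussian laws -/

section GaussianMoments

open scoped NNReal

/-! Each user has exactly one pilot. Orthonormality therefore makes the estimate of user `j` at one
antenna a linear combination of independent centred Gaussians: the channels of the users sharing the
pilot of `j`, and noise. The formula for `c` is the normal equation `Admissible.c_mul_pilotPower`,
so the estimation error is orthogonal to all observations. This gives LMMSE optimality, and the
second moment is `γ`.

The symbol of user `j` reaches user `k` with coefficient `crossGain`, a sum of independent terms
over the antennas of all access points. Each term has the form `G* (κ G + E)`, with `G` Gaussian and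
`E` centred and independent of `G`. The Gaussian fourth moment gives
`integral_norm_sq_conj_mul_of_indepFun`: the variance of such a term is `E|G|²` times the power of
the estimate. Means add coherently (the `L ^ 2` terms, present only under pilot sharing) and
variances incoherently (the `L` terms). The symbols are centred, of unit power and independent of
the coefficients, so powers add in `IsModel.superposition`, and the closed form follows.

For achievability, user `k` sees an affine channel `A x + N` with `(A, N)` independent of `x`. With
a Gaussian input, the Gibbs variational inequality is applied to the log-density ratio of a Gaussian
centred at the linear MMSE estimate of the input. It bounds the mutual information below by minus
the logarithm of the mean square error, which is `log (1 + SINR)`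
(`ofReal_logb_le_channelCapacity`). Finally, pilots enter the rate only through their inner
products, which are the same for all orthonormal families. -/

theorem integrable_pow_gaussianReal (v : ℝ≥0) (n : ℕ) :
    Integrable (fun x : ℝ => x ^ n) (gaussianReal 0 v) := by
  have h : MemLp id (n : ℝ≥0∞) (gaussianReal 0 v) :=
    memLp_id_gaussianReal' _ (ENNReal.natCast_ne_top n)
  have h2 := h.integrable_norm_pow'
  refine (integrable_norm_iff (by fun_prop)).1 ?_
  simpa [norm_pow] using h2

theorem integral_sq_gaussianReal (v : ℝ≥0) : ∫ x, x ^ 2 ∂gaussianReal 0 v = v := by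
  have h := variance_fun_id_gaussianReal (μ := 0) (v := v)
  rw [variance_eq_integral (by fun_prop)] at h
  simpa [integral_id_gaussianReal] using h

/-- The moment is the fourth derivative at `0` of the moment generating function `exp (v t² / 2)`.
Every derivative is a polynomial times this exponential, and `key` is the recursion `f ↦ f' + v t f`
for the polynomial factor. -/
theorem integral_pow_four_gaussianReal (v : ℝ≥0) :
    ∫ x, x ^ 4 ∂gaussianReal 0 v = 3 * (v : ℝ) ^ 2 := by
  have h := iteratedDeriv_mgf_zero (X := id) (μ := gaussianReal 0 v) (by simp) 4
  have key : ∀ (f f' : ℝ → ℝ), (∀ t, HasDerivAt f (f' t) t) →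
      deriv (fun t => f t * Real.exp (v * t ^ 2 / 2)) =
        fun t => (f' t + f t * (v * t)) * Real.exp (v * t ^ 2 / 2) := by
    intro f f' hf
    funext t
    have h1 : HasDerivAt (fun t : ℝ => (v : ℝ) * t ^ 2 / 2) (v * t) t := by
      have := ((hasDerivAt_pow 2 t).const_mul (v : ℝ)).div_const 2
      convert! this using 1
      simp; ring
    have := ((hf t).mul h1.exp).deriv
    convert! this using 1
    ring
  have e0 : mgf id (gaussianReal 0 v) = fun t => (1 : ℝ) * Real.exp (v * t ^ 2 / 2) := by
    rw [mgf_id_gaussianReal]; simp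
  have h1 : ∀ t : ℝ, HasDerivAt (fun _ : ℝ => (1 : ℝ)) 0 t := fun t => hasDerivAt_const t _
  have h2 : ∀ t : ℝ, HasDerivAt (fun t : ℝ => (v : ℝ) * t) v t := fun t => by
    simpa using (hasDerivAt_id t).const_mul (v : ℝ)
  have h3 : ∀ t : ℝ, HasDerivAt (fun t : ℝ => (v : ℝ) + v ^ 2 * t ^ 2) (2 * v ^ 2 * t) t :=
    fun t => by
      convert! ((hasDerivAt_pow 2 t).const_mul ((v : ℝ) ^ 2)).const_add (v : ℝ) using 1
      simp; ring
  have h4 : ∀ t : ℝ, HasDerivAt (fun t : ℝ => 3 * (v : ℝ) ^ 2 * t + v ^ 3 * t ^ 3)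
      (3 * v ^ 2 + 3 * v ^ 3 * t ^ 2) t := fun t => by
      convert! ((hasDerivAt_id t).const_mul (3 * (v : ℝ) ^ 2)).add
        ((hasDerivAt_pow 3 t).const_mul ((v : ℝ) ^ 3)) using 1
      simp; ring
  have d1 : deriv (mgf id (gaussianReal 0 v)) =
      fun t => ((v : ℝ) * t) * Real.exp (v * t ^ 2 / 2) := by
    rw [e0, key _ _ h1]; funext t; ring
  have d2 : deriv (deriv (mgf id (gaussianReal 0 v))) =
      fun t => ((v : ℝ) + v ^ 2 * t ^ 2) * Real.exp (v * t ^ 2 / 2) := by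
    rw [d1, key _ _ h2]; funext t; ring
  have d3 : deriv (deriv (deriv (mgf id (gaussianReal 0 v)))) =
      fun t => (3 * (v : ℝ) ^ 2 * t + v ^ 3 * t ^ 3) * Real.exp (v * t ^ 2 / 2) := by
    rw [d2, key _ _ h3]; funext t; ring
  rw [show (4 : ℕ) = 3 + 1 from rfl, iteratedDeriv_succ, iteratedDeriv_succ, iteratedDeriv_succ,
    iteratedDeriv_succ, iteratedDeriv_zero, d3, key _ _ h4] at h
  simpa using h.symm

theorem measurable_complex_mk : Measurable (fun z : ℝ × ℝ => (⟨z.1, z.2⟩ : ℂ)) :=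
  Complex.measurableEquivRealProd.symm.measurable

theorem measurableEmbedding_complex_mk :
    MeasurableEmbedding (fun z : ℝ × ℝ => (⟨z.1, z.2⟩ : ℂ)) :=
  Complex.measurableEquivRealProd.symm.measurableEmbedding

instance isProbabilityMeasure_complexGaussian (v : ℝ) :
    IsProbabilityMeasure (complexGaussian v) :=
  Measure.isProbabilityMeasure_map measurable_complex_mk.aemeasurable

theorem integral_complexGaussian {E : Type*} [NormedAddCommGroup E] [NormedSpace ℝ E]
    (v : ℝ) (f : ℂ → E) :
    ∫ z, f z ∂complexGaussian v = ∫ z : ℝ × ℝ, f ⟨z.1, z.2⟩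
      ∂(gaussianReal 0 (v / 2).toNNReal).prod (gaussianReal 0 (v / 2).toNNReal) :=
  measurableEmbedding_complex_mk.integral_map f

theorem integrable_pow_mul_pow_gaussianReal_prod (v : ℝ≥0) (a b : ℕ) :
    Integrable (fun z : ℝ × ℝ => z.1 ^ a * z.2 ^ b)
      ((gaussianReal 0 v).prod (gaussianReal 0 v)) :=
  (integrable_pow_gaussianReal v a).mul_prod (integrable_pow_gaussianReal v b)

theorem integral_pow_mul_pow_gaussianReal_prod (v : ℝ≥0) (a b : ℕ) :
    ∫ z : ℝ × ℝ, z.1 ^ a * z.2 ^ b ∂(gaussianReal 0 v).prod (gaussianReal 0 v) =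
      (∫ x, x ^ a ∂gaussianReal 0 v) * ∫ x, x ^ b ∂gaussianReal 0 v :=
  integral_prod_mul (fun x : ℝ => x ^ a) (fun x : ℝ => x ^ b)

theorem complex_norm_mk_sq (x y : ℝ) : ‖(⟨x, y⟩ : ℂ)‖ ^ 2 = x ^ 2 + y ^ 2 := by
  rw [← Complex.normSq_eq_norm_sq, Complex.normSq_mk]; ring

theorem integral_norm_sq_complexGaussian {v : ℝ} (hv : 0 ≤ v) :
    ∫ z, ‖z‖ ^ 2 ∂complexGaussian v = v := by
  rw [integral_complexGaussian]
  simp_rw [complex_norm_mk_sq]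
  have i1 := integrable_pow_mul_pow_gaussianReal_prod (v / 2).toNNReal 2 0
  have i2 := integrable_pow_mul_pow_gaussianReal_prod (v / 2).toNNReal 0 2
  have m1 := integral_pow_mul_pow_gaussianReal_prod (v / 2).toNNReal 2 0
  have m2 := integral_pow_mul_pow_gaussianReal_prod (v / 2).toNNReal 0 2
  simp only [pow_zero, mul_one, one_mul] at i1 i2 m1 m2
  rw [integral_add i1 i2, m1, m2, integral_sq_gaussianReal, Real.coe_toNNReal _ (by linarith)]
  simp

theorem integrable_norm_pow_four_complexGaussian (v : ℝ) :
    Integrable (fun z : ℂ => ‖z‖ ^ 4) (complexGaussian v) := by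
  rw [complexGaussian, measurableEmbedding_complex_mk.integrable_map_iff]
  have i1 := integrable_pow_mul_pow_gaussianReal_prod (v / 2).toNNReal 4 0
  have i2 := integrable_pow_mul_pow_gaussianReal_prod (v / 2).toNNReal 2 2
  have i3 := integrable_pow_mul_pow_gaussianReal_prod (v / 2).toNNReal 0 4
  refine ((i1.add (i2.const_mul 2)).add i3).congr (.of_forall fun z => ?_)
  simp only [Pi.add_apply, Function.comp]
  rw [show (4 : ℕ) = 2 * 2 from rfl, pow_mul ‖_‖, complex_norm_mk_sq]
  ring

/-- Expand `|z|⁴ = x⁴ + 2 x² y² + y⁴` with coordinates of variance `v / 2`: the terms contribute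
`3v²/4`, `v²/2` and `3v²/4`. -/
theorem integral_norm_pow_four_complexGaussian {v : ℝ} (hv : 0 ≤ v) :
    ∫ z, ‖z‖ ^ 4 ∂complexGaussian v = 2 * v ^ 2 := by
  rw [integral_complexGaussian]
  have i1 := integrable_pow_mul_pow_gaussianReal_prod (v / 2).toNNReal 4 0
  have i2 := integrable_pow_mul_pow_gaussianReal_prod (v / 2).toNNReal 2 2
  have i3 := integrable_pow_mul_pow_gaussianReal_prod (v / 2).toNNReal 0 4
  have e : ∀ z : ℝ × ℝ, ‖(⟨z.1, z.2⟩ : ℂ)‖ ^ 4 =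
      z.1 ^ 4 * z.2 ^ 0 + 2 * (z.1 ^ 2 * z.2 ^ 2) + z.1 ^ 0 * z.2 ^ 4 := fun z => by
    rw [show (4 : ℕ) = 2 * 2 from rfl, pow_mul ‖_‖, complex_norm_mk_sq]
    ring
  simp_rw [e]
  rw [integral_add (by exact i1.add (i2.const_mul 2)) i3, integral_add i1 (i2.const_mul 2),
    integral_const_mul]
  simp_rw [integral_pow_mul_pow_gaussianReal_prod]
  rw [integral_pow_four_gaussianReal, integral_sq_gaussianReal,
    Real.coe_toNNReal _ (by linarith)]
  simp
  ring

theorem memLp_four_complexGaussian (v : ℝ) : MemLp (id : ℂ → ℂ) 4 (complexGaussian v) := by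
  rw [← integrable_norm_rpow_iff (by fun_prop) (by norm_num) (by norm_num)]
  simpa using integrable_norm_pow_four_complexGaussian v

theorem integral_id_complexGaussian (v : ℝ) : ∫ z, z ∂complexGaussian v = 0 := by
  have hi : Integrable (fun z : ℂ => z) (complexGaussian v) :=
    (memLp_four_complexGaussian v).integrable (by norm_num)
  have m1 := integral_pow_mul_pow_gaussianReal_prod (v / 2).toNNReal 1 0
  have m2 := integral_pow_mul_pow_gaussianReal_prod (v / 2).toNNReal 0 1
  simp only [pow_zero, mul_one, one_mul, pow_one] at m1 m2
  apply Complex.ext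
  · rw [← RCLike.re_eq_complex_re, ← integral_re hi, integral_complexGaussian]
    simpa using m1.trans (by simp)
  · rw [← RCLike.im_eq_complex_im, ← integral_im hi, integral_complexGaussian]
    simpa using m2.trans (by simp)

variable {Ω : Type*} [MeasurableSpace Ω] {P : Measure Ω} {X : Ω → ℂ} {v : ℝ}

theorem memLp_four_of_map_complexGaussian (hm : Measurable X)
    (h : P.map X = complexGaussian v) : MemLp X 4 P := by
  have := memLp_four_complexGaussian v
  rw [← h, memLp_map_measure_iff (by fun_prop) hm.aemeasurable] at this
  exact this

theorem integral_of_map_complexGaussian (hm : Measurable X)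
    (h : P.map X = complexGaussian v) : ∫ ω, X ω ∂P = 0 := by
  rw [← integral_id_complexGaussian v, ← h, integral_map hm.aemeasurable (by fun_prop)]

theorem integral_norm_sq_of_map_complexGaussian (hv : 0 ≤ v) (hm : Measurable X)
    (h : P.map X = complexGaussian v) : ∫ ω, ‖X ω‖ ^ 2 ∂P = v := by
  rw [← integral_norm_sq_complexGaussian hv, ← h, integral_map hm.aemeasurable (by fun_prop)]

theorem integral_norm_pow_four_of_map_complexGaussian (hv : 0 ≤ v) (hm : Measurable X)
    (h : P.map X = complexGaussian v) : ∫ ω, ‖X ω‖ ^ 4 ∂P = 2 * v ^ 2 := by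
  rw [← integral_norm_pow_four_complexGaussian hv, ← h,
    integral_map hm.aemeasurable (by fun_prop)]

end GaussianMoments

/-! ### Second moments of complex random variables -/

section SecondMoments

variable {Ω : Type*} [MeasurableSpace Ω] {P : Measure Ω}

theorem MeasureTheory.MemLp.conj_complex {X : Ω → ℂ} {p : ℝ≥0∞} (hX : MemLp X p P) :
    MemLp (fun ω => conj (X ω)) p P :=
  hX.of_le (Complex.continuous_conj.comp_aestronglyMeasurable hX.1) (.of_forall fun ω => by simp)

theorem MeasureTheory.MemLp.integrable_mul_conj {X Y : Ω → ℂ} (hX : MemLp X 2 P)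
    (hY : MemLp Y 2 P) : Integrable (fun ω => X ω * conj (Y ω)) P :=
  MemLp.integrable_mul hX hY.conj_complex

theorem MeasureTheory.MemLp.integrable_norm_sq {X : Ω → ℂ} (hX : MemLp X 2 P) :
    Integrable (fun ω => ‖X ω‖ ^ 2) P :=
  (memLp_two_iff_integrable_sq_norm hX.1).1 hX

theorem integral_mul_conj_self (X : Ω → ℂ) :
    ∫ ω, X ω * conj (X ω) ∂P = ((∫ ω, ‖X ω‖ ^ 2 ∂P : ℝ) : ℂ) := by
  rw [← integral_complex_ofReal]
  simp [Complex.mul_conj']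

theorem integral_conj_complex (X : Ω → ℂ) :
    ∫ ω, conj (X ω) ∂P = conj (∫ ω, X ω ∂P) := integral_conj

theorem integral_sum_mul_conj_sum {ι κ : Type*} (s : Finset ι) (t : Finset κ)
    {X : ι → Ω → ℂ} {Y : κ → Ω → ℂ} (hX : ∀ i ∈ s, MemLp (X i) 2 P)
    (hY : ∀ j ∈ t, MemLp (Y j) 2 P) :
    ∫ ω, (∑ i ∈ s, X i ω) * conj (∑ j ∈ t, Y j ω) ∂P =
      ∑ i ∈ s, ∑ j ∈ t, ∫ ω, X i ω * conj (Y j ω) ∂P := by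
  simp_rw [map_sum, Finset.sum_mul_sum]
  rw [integral_finsetSum _ fun i hi => integrable_finsetSum _ fun j hj =>
    (hX i hi).integrable_mul_conj (hY j hj)]
  refine Finset.sum_congr rfl fun i hi => ?_
  rw [integral_finsetSum _ fun j hj => (hX i hi).integrable_mul_conj (hY j hj)]

/-- Second moments of linear combinations of an orthogonal family. -/
theorem integral_linearCombination_mul_conj {ι : Type*} [Fintype ι] [DecidableEq ι]
    {ξ : ι → Ω → ℂ} (v : ι → ℝ) (hξ : ∀ i, MemLp (ξ i) 2 P)
    (hv : ∀ i, ∫ ω, ‖ξ i ω‖ ^ 2 ∂P = v i)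
    (ho : ∀ i j, i ≠ j → ∫ ω, ξ i ω * conj (ξ j ω) ∂P = 0) (a b : ι → ℂ) :
    ∫ ω, (∑ i, a i * ξ i ω) * conj (∑ i, b i * ξ i ω) ∂P = ∑ i, a i * conj (b i) * v i := by
  rw [integral_sum_mul_conj_sum _ _ (fun i _ => (hξ i).const_mul (a i))
    (fun i _ => (hξ i).const_mul (b i))]
  refine Finset.sum_congr rfl fun i _ => ?_
  have e : ∀ j, ∫ ω, a i * ξ i ω * conj (b j * ξ j ω) ∂P =
      a i * conj (b j) * ∫ ω, ξ i ω * conj (ξ j ω) ∂P := fun j => by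
    rw [← integral_const_mul]
    congr 1; funext ω; rw [map_mul]; ring
  simp_rw [e]
  rw [Finset.sum_eq_single i (fun j _ hj => by rw [ho i j (Ne.symm hj), mul_zero]) (by simp),
    integral_mul_conj_self, hv]

theorem ProbabilityTheory.IndepFun.integral_mul_conj {X Y : Ω → ℂ} (h : IndepFun X Y P)
    (hX : AEStronglyMeasurable X P) (hY : AEStronglyMeasurable Y P) :
    ∫ ω, X ω * conj (Y ω) ∂P = (∫ ω, X ω ∂P) * conj (∫ ω, Y ω ∂P) := by
  have h' : IndepFun X (fun ω => conj (Y ω)) P :=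
    h.comp measurable_id (Complex.continuous_conj.measurable)
  rw [h'.integral_fun_mul_eq_mul_integral hX (Complex.continuous_conj.comp_aestronglyMeasurable hY),
    integral_conj_complex]

/-- The second moment of a sum of pairwise independent random variables. -/
theorem integral_norm_sq_sum_of_indepFun [IsProbabilityMeasure P] {ι : Type*} (s : Finset ι)
    {X : ι → Ω → ℂ} (hX : ∀ i ∈ s, MemLp (X i) 2 P)
    (hi : ∀ i ∈ s, ∀ j ∈ s, i ≠ j → IndepFun (X i) (X j) P) :
    ∫ ω, ‖∑ i ∈ s, X i ω‖ ^ 2 ∂P = ‖∑ i ∈ s, ∫ ω, X i ω ∂P‖ ^ 2 +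
      ∑ i ∈ s, (∫ ω, ‖X i ω‖ ^ 2 ∂P - ‖∫ ω, X i ω ∂P‖ ^ 2) := by
  classical
  apply Complex.ofReal_injective
  rw [← integral_mul_conj_self, integral_sum_mul_conj_sum s s hX hX]
  push_cast
  -- The squared norm of the total mean is also expanded into a double sum. Off-diagonal entries
  -- then agree by independence, and the diagonal gives the variances.
  rw [← Complex.mul_conj', map_sum, Finset.sum_mul_sum, ← Finset.sum_add_distrib]
  refine Finset.sum_congr rfl fun i his => ?_
  rw [← Finset.add_sum_erase s _ his, ← Finset.add_sum_erase s _ his, integral_mul_conj_self,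
    Complex.mul_conj', Finset.sum_congr rfl fun j hj => ?_]
  · ring
  · rw [Finset.mem_erase] at hj
    exact (hi i his j hj.2 hj.1.symm).integral_mul_conj (hX i his).1 (hX j hj.2).1

theorem integral_norm_sq_add_of_orthogonal {X Y : Ω → ℂ} (hX : MemLp X 2 P) (hY : MemLp Y 2 P)
    (ho : ∫ ω, X ω * conj (Y ω) ∂P = 0) :
    ∫ ω, ‖X ω + Y ω‖ ^ 2 ∂P = ∫ ω, ‖X ω‖ ^ 2 ∂P + ∫ ω, ‖Y ω‖ ^ 2 ∂P := by
  have e : ∀ ω, ‖X ω + Y ω‖ ^ 2 = ‖X ω‖ ^ 2 + ‖Y ω‖ ^ 2 + 2 * (X ω * conj (Y ω)).re := fun ω => by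
    simp_rw [← Complex.normSq_eq_norm_sq]; exact Complex.normSq_add _ _
  simp_rw [e]
  have hXY := hX.integrable_mul_conj hY
  have hre : ∫ ω, (X ω * conj (Y ω)).re ∂P = 0 := by
    have := integral_re hXY
    simp only [RCLike.re_eq_complex_re] at this
    rw [this, ho]; simp
  rw [integral_add (by exact hX.integrable_norm_sq.add hY.integrable_norm_sq)
      (by exact hXY.re.const_mul 2),
    integral_add hX.integrable_norm_sq hY.integrable_norm_sq, integral_const_mul, hre]
  simp

/-- Pythagoras: the centred variable is orthogonal to constants. -/
theorem integral_norm_sub_integral_sq [IsProbabilityMeasure P] {X : Ω → ℂ} (hX : MemLp X 2 P) :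
    ∫ ω, ‖X ω - ∫ ω', X ω' ∂P‖ ^ 2 ∂P = ∫ ω, ‖X ω‖ ^ 2 ∂P - ‖∫ ω', X ω' ∂P‖ ^ 2 := by
  set a := ∫ ω', X ω' ∂P with ha
  have hX1 : Integrable X P := hX.integrable (by norm_num)
  have h := integral_norm_sq_add_of_orthogonal (P := P) (X := fun ω => X ω - a) (Y := fun _ => a)
    (hX.sub (memLp_const a)) (memLp_const a) (by
      rw [integral_mul_const, integral_sub hX1 (integrable_const a), ← ha]; simp)
  simp only [sub_add_cancel, integral_const, probReal_univ, one_smul] at h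
  linarith

/-- A linear estimate whose error is orthogonal to all observations is an LMMSE estimate. -/
theorem isLMMSE_of_orthogonal {ι : Type*} [Fintype ι] {X Xhat : Ω → ℂ} {Y : ι → Ω → ℂ}
    (hX : MemLp X 2 P) (hY : ∀ i, MemLp (Y i) 2 P)
    (hlin : ∃ A : ι → ℂ, ∀ ω, Xhat ω = ∑ i, A i * Y i ω)
    (ho : ∀ i, ∫ ω, (X ω - Xhat ω) * conj (Y i ω) ∂P = 0) : IsLMMSE P X Y Xhat := by
  refine ⟨hlin, fun A => ?_⟩
  obtain ⟨A₀, hA₀⟩ := hlin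
  have hcomb : ∀ C : ι → ℂ, MemLp (fun ω => ∑ i, C i * Y i ω) 2 P := fun C =>
    memLp_finsetSum _ fun i _ => (hY i).const_mul (C i)
  have hXhat : MemLp Xhat 2 P := by
    rw [show Xhat = fun ω => ∑ i, A₀ i * Y i ω from funext hA₀]; exact hcomb A₀
  -- The error of a competitor is the error of `Xhat` plus a combination of observations, and these
  -- two parts are orthogonal.
  have e : ∀ ω, X ω - ∑ i, A i * Y i ω = (X ω - Xhat ω) + ∑ i, (A₀ i - A i) * Y i ω := fun ω => by
    simp_rw [hA₀ ω, sub_mul, Finset.sum_sub_distrib]; ring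
  simp_rw [e]
  rw [integral_norm_sq_add_of_orthogonal (by exact hX.sub hXhat) (hcomb _)]
  · exact le_add_of_nonneg_right (integral_nonneg fun ω => by positivity)
  · simp_rw [map_sum, Finset.mul_sum]
    rw [integral_finsetSum]
    · refine Finset.sum_eq_zero fun i _ => ?_
      rw [← mul_zero (conj (A₀ i - A i)), ← ho i, ← integral_const_mul]
      congr 1; funext ω; rw [map_mul]; ring
    · exact fun i _ => (hX.sub hXhat).integrable_mul_conj ((hY i).const_mul _)

/-- The product of independent square integrable random variables is square integrable. -/
theorem ProbabilityTheory.IndepFun.memLp_two_mul {X Y : Ω → ℂ} (h : IndepFun X Y P)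
    (hX : MemLp X 2 P) (hY : MemLp Y 2 P) : MemLp (fun ω => X ω * Y ω) 2 P := by
  rw [memLp_two_iff_integrable_sq_norm (by exact hX.1.mul hY.1)]
  have h' : IndepFun (fun ω => ‖X ω‖ ^ 2) (fun ω => ‖Y ω‖ ^ 2) P :=
    h.comp (φ := fun z : ℂ => ‖z‖ ^ 2) (ψ := fun z : ℂ => ‖z‖ ^ 2) (by fun_prop) (by fun_prop)
  refine (h'.integrable_mul hX.integrable_norm_sq hY.integrable_norm_sq).congr
    (.of_forall fun ω => ?_)
  simp [mul_pow]

theorem ProbabilityTheory.IndepFun.integral_norm_sq_mul {X Y : Ω → ℂ} (h : IndepFun X Y P)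
    (hX : MemLp X 2 P) (hY : MemLp Y 2 P) :
    ∫ ω, ‖X ω * Y ω‖ ^ 2 ∂P = (∫ ω, ‖X ω‖ ^ 2 ∂P) * ∫ ω, ‖Y ω‖ ^ 2 ∂P := by
  have h' : IndepFun (fun ω => ‖X ω‖ ^ 2) (fun ω => ‖Y ω‖ ^ 2) P :=
    h.comp (φ := fun z : ℂ => ‖z‖ ^ 2) (ψ := fun z : ℂ => ‖z‖ ^ 2) (by fun_prop) (by fun_prop)
  simp_rw [norm_mul, mul_pow]
  exact h'.integral_fun_mul_eq_mul_integral hX.integrable_norm_sq.1 hY.integrable_norm_sq.1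

/-! ### Affine channels whose gain and noise are jointly independent of the input. -/

section IndependentInput

variable {X A N : Ω → ℂ}

theorem memLp_mul_add_of_indepFun (h : IndepFun X (fun ω => (A ω, N ω)) P)
    (hX : MemLp X 2 P) (hA : MemLp A 2 P) (hN : MemLp N 2 P) :
    MemLp (fun ω => A ω * X ω + N ω) 2 P := by
  have hXA : IndepFun A X P := (h.comp measurable_id measurable_fst).symm
  exact (hXA.memLp_two_mul hA hX).add hN

/-- Second moment of the output of an affine channel with a centred unit power input. -/
theorem integral_norm_sq_mul_add_of_indepFun (h : IndepFun X (fun ω => (A ω, N ω)) P)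
    (hX : MemLp X 2 P) (hA : MemLp A 2 P) (hN : MemLp N 2 P)
    (hX0 : ∫ ω, X ω ∂P = 0) (hX1 : ∫ ω, ‖X ω‖ ^ 2 ∂P = 1) :
    ∫ ω, ‖A ω * X ω + N ω‖ ^ 2 ∂P = ∫ ω, ‖A ω‖ ^ 2 ∂P + ∫ ω, ‖N ω‖ ^ 2 ∂P := by
  have hXA : IndepFun A X P := (h.comp measurable_id measurable_fst).symm
  -- `A` and `N` may be dependent. Independence of `X` from the pair lets the mean of `X` factor out
  -- of the cross term.
  have hXAN : IndepFun X (fun ω => A ω * conj (N ω)) P :=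
    h.comp (ψ := fun z : ℂ × ℂ => z.1 * conj z.2) measurable_id
      (measurable_fst.mul (Complex.continuous_conj.measurable.comp measurable_snd))
  rw [integral_norm_sq_add_of_orthogonal (hXA.memLp_two_mul hA hX) hN,
    hXA.integral_norm_sq_mul hA hX, hX1, mul_one]
  have e : ∀ ω, A ω * X ω * conj (N ω) = X ω * (A ω * conj (N ω)) := fun ω => by ring
  simp_rw [e]
  rw [hXAN.integral_fun_mul_eq_mul_integral hX.1 (hA.integrable_mul_conj hN).1, hX0, zero_mul]

/-- Correlation of input and output of an affine channel. -/
theorem integral_mul_add_mul_conj_of_indepFun (h : IndepFun X (fun ω => (A ω, N ω)) P)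
    [IsProbabilityMeasure P]
    (hX : MemLp X 2 P) (hA : MemLp A 2 P) (hN : MemLp N 2 P)
    (hX0 : ∫ ω, X ω ∂P = 0) (hX1 : ∫ ω, ‖X ω‖ ^ 2 ∂P = 1) :
    ∫ ω, (A ω * X ω + N ω) * conj (X ω) ∂P = ∫ ω, A ω ∂P := by
  have hXA : IndepFun A X P := (h.comp measurable_id measurable_fst).symm
  have hNX : IndepFun N X P := (h.comp measurable_id measurable_snd).symm
  have hAXX : IndepFun A (fun ω => X ω * conj (X ω)) P :=
    hXA.comp (ψ := fun z : ℂ => z * conj z) measurable_id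
      (measurable_id.mul Complex.continuous_conj.measurable)
  have e : ∀ ω, (A ω * X ω + N ω) * conj (X ω) =
    A ω * (X ω * conj (X ω)) + N ω * conj (X ω) := fun ω => by ring
  simp_rw [e]
  rw [integral_add
      (by exact hAXX.integrable_mul (hA.integrable (by norm_num)) (hX.integrable_mul_conj hX))
      (hN.integrable_mul_conj hX),
    hAXX.integral_fun_mul_eq_mul_integral hA.1 (hX.integrable_mul_conj hX).1,
    hNX.integral_mul_conj hN.1 hX.1, hX0, integral_mul_conj_self, hX1]
  simp

end IndependentInput

end SecondMoments

/-! ### A Gaussian lower bound for mutual information -/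

section Capacity

/-- The Gibbs variational lower bound for the Kullback-Leibler divergence. -/
theorem ofReal_integral_le_klDiv {α : Type*} [MeasurableSpace α] {J Q : Measure α}
    [IsProbabilityMeasure J] [IsProbabilityMeasure Q] {f : α → ℝ} (hfJ : Integrable f J)
    (hfQ : Integrable (fun x => Real.exp (f x)) Q) (h1 : ∫ x, Real.exp (f x) ∂Q = 1) :
    ENNReal.ofReal (∫ x, f x ∂J) ≤ InformationTheory.klDiv J Q := by
  by_cases hac : J ≪ Q
  swap
  · simp [InformationTheory.klDiv_of_not_ac hac]
  by_cases hllr : Integrable (llr J Q) J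
  swap
  · simp [InformationTheory.klDiv_of_not_integrable hllr]
  -- By `h1` the tilted measure has density `exp f` with respect to `Q`. The divergence of `J` from
  -- it is nonnegative and equals the divergence from `Q` minus `∫ f ∂J`.
  have := isProbabilityMeasure_tilted hfQ
  have hac' : J ≪ Q.tilted f := hac.trans (absolutelyContinuous_tilted hfQ)
  have h0 := InformationTheory.integral_llr_add_sub_measure_univ_nonneg hac'
    (integrable_llr_tilted_right hac hfJ hllr hfQ)
  rw [integral_llr_tilted_right hac hfJ hfQ hllr, h1] at h0
  rw [InformationTheory.klDiv_of_ac_of_integrable hac hllr]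
  apply ENNReal.ofReal_le_ofReal
  simp at h0 ⊢
  linarith

/-- The integrand is the density of `N(b, s/2)` relative to `N(0, 1/2)`. -/
theorem lintegral_exp_sub_gaussianReal {s : ℝ} (hs : 0 < s) (b : ℝ) :
    ∫⁻ u, ENNReal.ofReal ((√s)⁻¹ * Real.exp (u ^ 2 - (u - b) ^ 2 / s))
      ∂gaussianReal 0 ((1 : ℝ) / 2).toNNReal = 1 := by
  have hv : ((1 : ℝ) / 2).toNNReal ≠ 0 := by simp
  have hv' : (s / 2).toNNReal ≠ 0 := by simpa using hs
  rw [gaussianReal_of_var_ne_zero _ hv,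
    lintegral_withDensity_eq_lintegral_mul _ (measurable_gaussianPDF _ _) (by fun_prop),
    ← lintegral_gaussianPDF_eq_one b hv']
  refine lintegral_congr fun u => ?_
  rw [Pi.mul_apply, gaussianPDF, gaussianPDF, ← ENNReal.ofReal_mul (gaussianPDFReal_nonneg _ _ _)]
  congr 1
  rw [gaussianPDFReal, gaussianPDFReal, Real.coe_toNNReal _ (by norm_num),
    Real.coe_toNNReal _ (by positivity)]
  rw [mul_mul_mul_comm, ← mul_inv, ← Real.sqrt_mul (by positivity), ← Real.exp_add]
  congr 3
  · ring
  · field_simp; ring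

/-- The integrand is the density of `CN(b, s)` relative to `CN(0, 1)`, a product over the two
coordinates. The value does not depend on `b`, which will be a function of the channel output. -/
theorem lintegral_exp_sub_complexGaussian {s : ℝ} (hs : 0 < s) (b : ℂ) :
    ∫⁻ x, ENNReal.ofReal (Real.exp (-Real.log s + ‖x‖ ^ 2 - ‖x - b‖ ^ 2 / s))
      ∂complexGaussian 1 = 1 := by
  have h := lintegral_prod_mul
    (μ := gaussianReal 0 ((1 : ℝ) / 2).toNNReal) (ν := gaussianReal 0 ((1 : ℝ) / 2).toNNReal)
    (f := fun u => ENNReal.ofReal ((√s)⁻¹ * Real.exp (u ^ 2 - (u - b.re) ^ 2 / s)))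
    (g := fun u => ENNReal.ofReal ((√s)⁻¹ * Real.exp (u ^ 2 - (u - b.im) ^ 2 / s)))
    (by fun_prop) (by fun_prop)
  rw [lintegral_exp_sub_gaussianReal hs, lintegral_exp_sub_gaussianReal hs, mul_one] at h
  rw [complexGaussian, measurableEmbedding_complex_mk.lintegral_map, ← h]
  refine lintegral_congr fun z => ?_
  rw [← ENNReal.ofReal_mul (by positivity)]
  congr 1
  have e : (⟨z.1, z.2⟩ : ℂ) - b = ⟨z.1 - b.re, z.2 - b.im⟩ := rfl
  rw [e, complex_norm_mk_sq, complex_norm_mk_sq, mul_mul_mul_comm, ← Real.exp_add, ← mul_inv,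
    Real.mul_self_sqrt hs.le, ← Real.exp_log (inv_pos.2 hs), ← Real.exp_add, Real.log_inv]
  congr 1
  ring

variable {Ω : Type*} [MeasurableSpace Ω] {P : Measure Ω} [IsProbabilityMeasure P]

/-- Lower bound on the mutual information across a channel with Gaussian input through the mean
square error of a linear estimate of the input from the output. -/
theorem ofReal_le_mutualInfo_complexGaussian {T : ℂ → Ω → ℂ}
    (hT : Measurable fun z : ℂ × Ω => T z.1 z.2)
    (hT2 : MemLp (fun z : ℂ × Ω => T z.1 z.2) 2 ((complexGaussian 1).prod P))
    (α : ℂ) {s : ℝ} (hs : 0 < s)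
    (hα : ∫ z : ℂ × Ω, ‖z.1 - α * T z.1 z.2‖ ^ 2 ∂(complexGaussian 1).prod P = s) :
    ENNReal.ofReal (-Real.log s) ≤ mutualInfo P T (complexGaussian 1) := by
  set μ := complexGaussian 1 with hμ
  set ν := (μ.prod P).map (fun z : ℂ × Ω => T z.1 z.2) with hν
  have : IsProbabilityMeasure ν := Measure.isProbabilityMeasure_map hT.aemeasurable
  have hpair : Measurable (fun z : ℂ × Ω => (z.1, T z.1 z.2)) := measurable_fst.prodMk hT
  have : IsProbabilityMeasure ((μ.prod P).map (fun z : ℂ × Ω => (z.1, T z.1 z.2))) :=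
    Measure.isProbabilityMeasure_map hpair.aemeasurable
  -- The log-density of `CN(α y, s)` relative to the input law, a Gaussian guess for the law of the
  -- input given the output `y`. Under the joint law its mean is `-log s + 1 - 1`.
  let f : ℂ × ℂ → ℝ := fun z => -Real.log s + ‖z.1‖ ^ 2 - ‖z.1 - α * z.2‖ ^ 2 / s
  have hf : Measurable f := by fun_prop
  have hx : MemLp (fun z : ℂ × Ω => z.1) 2 (μ.prod P) := by
    have h4 : MemLp (id : ℂ → ℂ) 2 μ := (memLp_four_complexGaussian 1).mono_exponent (by norm_num)
    exact h4.comp_measurePreserving measurePreserving_fst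
  have i1 := hx.integrable_norm_sq
  have i2 : Integrable (fun z : ℂ × Ω => ‖z.1 - α * T z.1 z.2‖ ^ 2) (μ.prod P) :=
    (hx.sub (hT2.const_mul α)).integrable_norm_sq
  have hx1 : ∫ z : ℂ × Ω, ‖z.1‖ ^ 2 ∂μ.prod P = 1 := by
    have := integral_fun_fst (μ := μ) (ν := P) (fun x : ℂ => ‖x‖ ^ 2)
    rw [this, integral_norm_sq_complexGaussian zero_le_one]
    simp
  have iJ : Integrable (fun z : ℂ × Ω => f (z.1, T z.1 z.2)) (μ.prod P) :=
    ((integrable_const _).add i1).sub (i2.div_const s)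
  have hfJ : Integrable f ((μ.prod P).map (fun z : ℂ × Ω => (z.1, T z.1 z.2))) :=
    (integrable_map_measure hf.aestronglyMeasurable hpair.aemeasurable).2 iJ
  have hval : ∫ z, f z ∂((μ.prod P).map (fun z : ℂ × Ω => (z.1, T z.1 z.2))) = -Real.log s := by
    rw [integral_map hpair.aemeasurable hf.aestronglyMeasurable]
    simp only [f]
    rw [integral_sub (by exact (integrable_const _).add i1) (i2.div_const s),
      integral_add (integrable_const _) i1, integral_div, hα, hx1, div_self hs.ne']
    simp
  have hl : ∫⁻ z, ENNReal.ofReal (Real.exp (f z)) ∂μ.prod ν = 1 := by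
    -- Integrating over the input first gives `1` for each fixed output, whatever the output law.
    rw [lintegral_prod_symm' _ (by fun_prop)]
    simp only [f]
    simp_rw [hμ, lintegral_exp_sub_complexGaussian hs]
    simp
  have hQ : Integrable (fun z => Real.exp (f z)) (μ.prod ν) := by
    refine ⟨by fun_prop, ?_⟩
    rw [hasFiniteIntegral_iff_ofReal (.of_forall fun z => (Real.exp_pos _).le), hl]
    exact ENNReal.one_lt_top
  have hQ1 : ∫ z, Real.exp (f z) ∂μ.prod ν = 1 := by
    rw [integral_eq_lintegral_of_nonneg_ae (.of_forall fun z => (Real.exp_pos _).le) hQ.1, hl]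
    simp
  rw [← hval]
  exact ofReal_integral_le_klDiv hfJ hQ hQ1

/-- Use-and-then-forget bound: the channel `x ↦ A x + N` carries at least the information of the
Gaussian channel with gain `E A` and noise power `E |A - E A| ^ 2 + E |N| ^ 2`. -/
theorem ofReal_logb_le_channelCapacity {A N : Ω → ℂ} (hAm : Measurable A) (hNm : Measurable N)
    (hA : MemLp A 2 P) (hN : MemLp N 2 P) {V : ℝ} (hV : 0 < V)
    (hAN : ∫ ω, ‖A ω‖ ^ 2 ∂P + ∫ ω, ‖N ω‖ ^ 2 ∂P = ‖∫ ω, A ω ∂P‖ ^ 2 + V) :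
    ENNReal.ofReal (Real.logb 2 (1 + ‖∫ ω, A ω ∂P‖ ^ 2 / V)) ≤
      channelCapacity P (fun x ω => A ω * x + N ω) := by
  set a := ∫ ω, A ω ∂P with ha
  set μ := complexGaussian 1 with hμ
  have hx : MemLp (fun z : ℂ × Ω => z.1) 2 (μ.prod P) := by
    have h4 : MemLp (id : ℂ → ℂ) 2 μ := (memLp_four_complexGaussian 1).mono_exponent (by norm_num)
    exact h4.comp_measurePreserving measurePreserving_fst
  have hA' : MemLp (fun z : ℂ × Ω => A z.2) 2 (μ.prod P) :=
    hA.comp_measurePreserving measurePreserving_snd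
  have hN' : MemLp (fun z : ℂ × Ω => N z.2) 2 (μ.prod P) :=
    hN.comp_measurePreserving measurePreserving_snd
  have hind : IndepFun (fun z : ℂ × Ω => z.1) (fun z : ℂ × Ω => (A z.2, N z.2)) (μ.prod P) :=
    indepFun_prod (X := fun x : ℂ => x) (Y := fun ω => (A ω, N ω)) measurable_id
      (hAm.prodMk hNm)
  have hx0 : ∫ z : ℂ × Ω, z.1 ∂μ.prod P = 0 := by
    rw [integral_fun_fst (fun x : ℂ => x), integral_id_complexGaussian]; simp
  have hx1 : ∫ z : ℂ × Ω, ‖z.1‖ ^ 2 ∂μ.prod P = 1 := by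
    rw [integral_fun_fst (fun x : ℂ => ‖x‖ ^ 2), integral_norm_sq_complexGaussian zero_le_one]
    simp
  have hy := memLp_mul_add_of_indepFun hind hx hA' hN'
  have hy2 := integral_norm_sq_mul_add_of_indepFun hind hx hA' hN' hx0 hx1
  have hxy := integral_mul_add_mul_conj_of_indepFun hind hx hA' hN' hx0 hx1
  have eA : ∫ z : ℂ × Ω, A z.2 ∂μ.prod P = a := by rw [integral_fun_snd A]; simp [ha]
  have eA2 : ∫ z : ℂ × Ω, ‖A z.2‖ ^ 2 ∂μ.prod P = ∫ ω, ‖A ω‖ ^ 2 ∂P := by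
    rw [integral_fun_snd (fun ω => ‖A ω‖ ^ 2)]; simp
  have eN2 : ∫ z : ℂ × Ω, ‖N z.2‖ ^ 2 ∂μ.prod P = ∫ ω, ‖N ω‖ ^ 2 ∂P := by
    rw [integral_fun_snd (fun ω => ‖N ω‖ ^ 2)]; simp
  rw [eA2, eN2, hAN] at hy2
  rw [eA] at hxy
  have hD : 0 < ‖a‖ ^ 2 + V := by positivity
  set D := ‖a‖ ^ 2 + V with hDdef
  -- The linear MMSE coefficient `E[x y*] / E|y|²`. Its mean square error is `V / D`, and `D / V = 1
  -- + ‖a‖² / V`.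
  set α : ℂ := conj a / D with hα
  have hDC : (D : ℂ) ≠ 0 := by exact_mod_cast hD.ne'
  have horth : ∫ z : ℂ × Ω, (z.1 - α * (A z.2 * z.1 + N z.2)) *
      conj (α * (A z.2 * z.1 + N z.2)) ∂μ.prod P = 0 := by
    have e : ∀ z : ℂ × Ω, (z.1 - α * (A z.2 * z.1 + N z.2)) * conj (α * (A z.2 * z.1 + N z.2)) =
        conj α * conj ((A z.2 * z.1 + N z.2) * conj z.1) -
          α * conj α * ((A z.2 * z.1 + N z.2) * conj (A z.2 * z.1 + N z.2)) := fun z => by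
      simp only [map_mul, map_add, Complex.conj_conj]; ring
    simp_rw [e]
    have j1 : Integrable (fun z : ℂ × Ω => conj ((A z.2 * z.1 + N z.2) * conj z.1)) (μ.prod P) :=
      (memLp_one_iff_integrable.2 (hy.integrable_mul_conj hx)).conj_complex.integrable le_rfl
    rw [integral_sub (j1.const_mul _) ((hy.integrable_mul_conj hy).const_mul _),
      integral_const_mul, integral_const_mul, integral_conj_complex, hxy, integral_mul_conj_self,
      hy2, hα]
    simp only [map_div₀, Complex.conj_conj, Complex.conj_ofReal]
    field_simp
    ring
  have hsum := integral_norm_sq_add_of_orthogonal (by exact hx.sub (hy.const_mul α))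
    (hy.const_mul α) horth
  have hα2 : ‖α‖ ^ 2 * D = ‖a‖ ^ 2 / D := by
    rw [hα, norm_div, RCLike.norm_conj, Complex.norm_real, Real.norm_of_nonneg hD.le]
    field_simp
  have hmse : ∫ z : ℂ × Ω, ‖z.1 - α * (A z.2 * z.1 + N z.2)‖ ^ 2 ∂μ.prod P = V / D := by
    simp only [sub_add_cancel] at hsum
    rw [hx1] at hsum
    simp_rw [norm_mul α, mul_pow] at hsum
    rw [integral_const_mul, hy2, hα2] at hsum
    have : V / D = 1 - ‖a‖ ^ 2 / D := by field_simp; rw [hDdef]; ring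
    rw [this]
    linarith
  have hTm : Measurable (fun z : ℂ × Ω => A z.2 * z.1 + N z.2) := by fun_prop
  have key := ofReal_le_mutualInfo_complexGaussian (P := P) (T := fun x ω => A ω * x + N ω)
    hTm hy α (div_pos hV hD) hmse
  have hlog : Real.logb 2 (1 + ‖a‖ ^ 2 / V) = -Real.log (V / D) / Real.log 2 := by
    rw [Real.logb, ← Real.log_inv, inv_div]
    congr 2
    field_simp
    rw [hDdef]; ring
  rw [hlog, ENNReal.ofReal_div_of_pos (Real.log_pos one_lt_two)]
  refine (ENNReal.div_le_div_right key _).trans ?_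
  -- The Gaussian input is one admissible law in the supremum.
  exact le_iSup_of_le μ (le_iSup_of_le inferInstance
    (le_iSup_of_le (integral_norm_sq_complexGaussian zero_le_one) le_rfl))

end Capacity

/-! ### Cell-free systems: deterministic identities -/

namespace CellFree

variable {M K L τ : ℕ} {Ω : Type*}

/-- `t k` is the index of the pilot assigned to user `k`. -/
def IsPilotIndex (S : CellFree M K L τ) (t : Fin K → Fin τ) : Prop :=
  ∀ k s, S.p k s = if s = t k then 1 else 0

theorem Admissible.exists_isPilotIndex {S : CellFree M K L τ} (hS : S.Admissible) :
    ∃ t, S.IsPilotIndex t := by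
  have h : ∀ k, ∃ t, ∀ s, S.p k s = if s = t then 1 else 0 := by
    intro k
    obtain ⟨t, -, ht⟩ : ∃ t ∈ Finset.univ, S.p k t ≠ 0 :=
      Finset.exists_ne_zero_of_sum_ne_zero (by rw [hS.p_sum k]; exact one_ne_zero)
    have ht1 : S.p k t = 1 := (hS.p_binary k t).resolve_left ht
    refine ⟨t, fun s => ?_⟩
    split_ifs with hs
    · rw [hs, ht1]
    · have hsum := hS.p_sum k
      rw [← Finset.add_sum_erase _ _ (Finset.mem_univ t), ht1] at hsum
      -- The indicators are natural numbers, so a vanishing sum forces each term to vanish.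
      have h0 : ∑ x ∈ Finset.univ.erase t, S.p k x = 0 := by omega
      exact Finset.sum_eq_zero_iff.1 h0 s (Finset.mem_erase.2 ⟨hs, Finset.mem_univ s⟩)
  choose t ht using h
  exact ⟨t, ht⟩

variable {S : CellFree M K L τ} {t : Fin K → Fin τ}

theorem IsPilotIndex.sum_mul (ht : S.IsPilotIndex t) (k : Fin K) (F : Fin τ → ℂ) :
    ∑ s, (S.p k s : ℂ) * F s = F (t k) := by
  simp [ht k]

theorem Admissible.inner_pilot (hS : S.Admissible) (s r : Fin τ) :
    inner ℂ (S.φ s) (S.φ r) = if s = r then (1 : ℂ) else 0 :=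
  orthonormal_iff_ite.1 hS.φ_orthonormal s r

/-- The normalized power of the pilot-phase signal at access point `m` along the pilot of user
`k`. -/
noncomputable def pilotPower (S : CellFree M K L τ) (t : Fin K → Fin τ) (m : Fin M) (k : Fin K) :
    ℝ :=
  τ * S.ρp * ∑ j, (if t j = t k then S.β m j else 0) + 1

theorem Admissible.pilotPower_pos (hS : S.Admissible) (t : Fin K → Fin τ) (m : Fin M)
    (k : Fin K) : 0 < S.pilotPower t m k := by
  have h1 : 0 ≤ ∑ j, (if t j = t k then S.β m j else 0) :=
    Finset.sum_nonneg fun j _ => by split_ifs; exacts [(hS.β_pos m j).le, le_rfl]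
  have := hS.ρp_nonneg
  unfold pilotPower
  positivity

/-- Orthonormality collapses the triple sum in the denominator to the users sharing the pilot of
`k`. -/
theorem Admissible.c_eq (hS : S.Admissible) (ht : S.IsPilotIndex t) (m : Fin M) (k : Fin K) :
    S.c m k = √(τ * S.ρp) * S.β m k / S.pilotPower t m k := by
  unfold c pilotPower
  congr 4
  funext j
  have e : ∀ s' s, S.β m j * ‖(S.p j s' : ℂ) * (S.p k s : ℂ) * inner ℂ (S.φ s') (S.φ s)‖ =
      if s' = t j then (if s = t k then (if t j = t k then S.β m j else 0) else 0) else 0 := by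
    intro s' s
    rw [hS.inner_pilot, ht j s', ht k s]
    split_ifs <;> simp_all
  simp_rw [e]
  simp

/-- The normal equation of the LMMSE problem for the signal projected on the pilot of `k`. -/
theorem Admissible.c_mul_pilotPower (hS : S.Admissible) (ht : S.IsPilotIndex t) (m : Fin M)
    (k : Fin K) : S.c m k * S.pilotPower t m k = √(τ * S.ρp) * S.β m k := by
  rw [hS.c_eq ht, div_mul_cancel₀ _ (hS.pilotPower_pos t m k).ne']

theorem Admissible.norm_sum_inner_pilot (hS : S.Admissible) (ht : S.IsPilotIndex t)
    (j k : Fin K) :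
    ‖∑ s, ∑ s', (S.p j s : ℂ) * (S.p k s' : ℂ) * inner ℂ (S.φ s) (S.φ s')‖ =
      if t j = t k then 1 else 0 := by
  simp_rw [mul_assoc, ← Finset.mul_sum, ht.sum_mul, hS.inner_pilot]
  split_ifs <;> simp

/-- All orthonormal families have the same Gram matrix, so both rates reduce to the same expression
in the pilot index. -/
theorem Admissible.downlinkRate_eq_of_orthonormal (hS : S.Admissible) (k : Fin K)
    (φ' : Fin τ → EuclideanSpace ℂ (Fin τ)) (hφ' : Orthonormal ℂ φ') :
    ({ S with φ := φ' } : CellFree M K L τ).downlinkRate k = S.downlinkRate k := by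
  have hS' : ({ S with φ := φ' } : CellFree M K L τ).Admissible :=
    { hS with φ_orthonormal := hφ' }
  obtain ⟨t, ht⟩ := hS.exists_isPilotIndex
  have ht' : ({ S with φ := φ' } : CellFree M K L τ).IsPilotIndex t := ht
  have hγ : ∀ m j, ({ S with φ := φ' } : CellFree M K L τ).γ m j = S.γ m j := fun m j => by
    unfold γ
    rw [hS.c_eq ht, hS'.c_eq ht']
    rfl
  unfold downlinkRate
  simp_rw [hS.norm_sum_inner_pilot ht, hγ]
  congr! 8
  simp_rw [hS'.norm_sum_inner_pilot ht']

/-! ### Linear representations of the pilot-phase signals -/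

/-- The channels and pilot-phase noises at antenna `l` of access point `m`. -/
def antennaRV (Z : CellFreeRV M K L τ Ω) (m : Fin M) (l : Fin L) : Fin K ⊕ Fin τ → Ω → ℂ :=
  Sum.elim (fun i => Z.g m i l) (fun s => Z.W m l s)

/-- The second moments of `antennaRV`. -/
def antennaVar (S : CellFree M K L τ) (m : Fin M) : Fin K ⊕ Fin τ → ℝ :=
  Sum.elim (S.β m) (fun _ => 1)

/-- The coefficients of the received pilot-phase signal in `antennaRV`. -/
noncomputable def rxCoef (S : CellFree M K L τ) (t : Fin K → Fin τ) (s : Fin τ) :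
    Fin K ⊕ Fin τ → ℂ :=
  Sum.elim (fun i => (√(τ * S.ρp) : ℂ) * conj (S.φ (t i) s)) (fun s' => if s' = s then 1 else 0)

/-- The coefficients of the channel estimate in `antennaRV`. -/
noncomputable def estCoef (S : CellFree M K L τ) (t : Fin K → Fin τ) (m : Fin M) (j : Fin K) :
    Fin K ⊕ Fin τ → ℂ :=
  Sum.elim (fun i => if t i = t j then (√(τ * S.ρp) : ℂ) * S.c m j else 0)
    (fun s => S.c m j * S.φ (t j) s)

theorem IsPilotIndex.pilotRx_eq (ht : S.IsPilotIndex t) (Z : CellFreeRV M K L τ Ω) (m : Fin M)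
    (l : Fin L) (s : Fin τ) (ω : Ω) :
    S.pilotRx Z m l s ω = ∑ i, S.rxCoef t s i * antennaRV Z m l i ω := by
  simp only [pilotRx, mul_assoc, ht.sum_mul, Fintype.sum_sum_type, rxCoef, antennaRV,
    Sum.elim_inl, Sum.elim_inr, ite_mul, one_mul, zero_mul, Finset.sum_ite_eq', Finset.mem_univ,
    if_true, Finset.mul_sum]
  congr 1
  refine Finset.sum_congr rfl fun i _ => ?_
  ring

theorem IsPilotIndex.estimate_eq_sum_pilotRx (ht : S.IsPilotIndex t) (Z : CellFreeRV M K L τ Ω)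
    (m : Fin M) (j : Fin K) (l : Fin L) (ω : Ω) :
    S.estimate Z m j l ω = S.c m j * ∑ s, S.pilotRx Z m l s ω * S.φ (t j) s := by
  unfold estimate
  congr 1
  refine Finset.sum_congr rfl fun s _ => ?_
  rw [ht.sum_mul j (fun x => S.φ x s)]

theorem Admissible.sum_conj_pilot_mul (hS : S.Admissible) (a b : Fin τ) :
    ∑ s, conj (S.φ a s) * S.φ b s = if a = b then 1 else 0 := by
  rw [← hS.inner_pilot a b, PiLp.inner_apply]
  refine Finset.sum_congr rfl fun s _ => ?_
  rw [RCLike.inner_apply, mul_comm]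

/-- Correlating with the pilot of `j` removes every user with another pilot. Users with the same
pilot all survive with one common coefficient: this is pilot contamination. -/
theorem Admissible.estimate_eq (hS : S.Admissible) (ht : S.IsPilotIndex t)
    (Z : CellFreeRV M K L τ Ω) (m : Fin M) (j : Fin K) (l : Fin L) (ω : Ω) :
    S.estimate Z m j l ω = ∑ i, S.estCoef t m j i * antennaRV Z m l i ω := by
  rw [ht.estimate_eq_sum_pilotRx]
  simp_rw [ht.pilotRx_eq, Finset.sum_mul]
  rw [Finset.sum_comm, Finset.mul_sum]
  refine Finset.sum_congr rfl fun i _ => ?_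
  have e : ∀ s, S.rxCoef t s i * antennaRV Z m l i ω * S.φ (t j) s =
    antennaRV Z m l i ω * (S.rxCoef t s i * S.φ (t j) s) := fun s => by ring
  simp_rw [e]
  rw [← Finset.mul_sum, mul_left_comm, mul_comm]
  congr 1
  rcases i with i | s'
  · simp only [rxCoef, estCoef, Sum.elim_inl, mul_assoc, ← Finset.mul_sum, hS.sum_conj_pilot_mul]
    split_ifs <;> ring
  · simp [rxCoef, estCoef]

/-- The left side is the correlation of the estimate with an observation at the same antenna; the
right side is that of the true channel. Their equality is the orthogonality of the error. -/
theorem sum_estCoef_mul_conj_rxCoef (hS : S.Admissible) (ht : S.IsPilotIndex t) (m : Fin M)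
    (j : Fin K) (s : Fin τ) :
    ∑ i, S.estCoef t m j i * conj (S.rxCoef t s i) * S.antennaVar m i =
      √(τ * S.ρp) * S.β m j * S.φ (t j) s := by
  have hsq : (√(τ * S.ρp) : ℂ) * √(τ * S.ρp) = ((τ * S.ρp : ℝ) : ℂ) := by
    rw [← Complex.ofReal_mul, Real.mul_self_sqrt (mul_nonneg τ.cast_nonneg hS.ρp_nonneg)]
  have hc : (S.c m j : ℂ) * S.pilotPower t m j = √(τ * S.ρp) * S.β m j := by
    exact_mod_cast congrArg (fun x : ℝ => (x : ℂ)) (hS.c_mul_pilotPower ht m j)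
  -- In `pilotPower`, the sum comes from the channels and the `+ 1` from the noise.
  rw [← hc, Fintype.sum_sum_type]
  simp only [estCoef, rxCoef, antennaVar, Sum.elim_inl, Sum.elim_inr, pilotPower]
  have e : ∀ i, (if t i = t j then (√(τ * S.ρp) : ℂ) * S.c m j else 0) *
      conj ((√(τ * S.ρp) : ℂ) * conj (S.φ (t i) s)) * S.β m i =
      ((τ * S.ρp : ℝ) : ℂ) * S.c m j * S.φ (t j) s *
        ((if t i = t j then S.β m i else 0 : ℝ) : ℂ) := fun i => by
    rw [← hsq]
    split_ifs with h
    · simp only [map_mul, Complex.conj_ofReal, Complex.conj_conj, h]; ring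
    · simp
  simp_rw [e, ← Finset.mul_sum]
  simp only [apply_ite (starRingEnd ℂ), map_one, map_zero, mul_ite, mul_one, mul_zero,
    Finset.sum_ite_eq', Finset.mem_univ, if_true, Complex.ofReal_one]
  push_cast
  ring

/-- This is the power of the estimate. As pilots have unit norm it equals `c² · pilotPower`, and one
factor `c` is absorbed by the normal equation. -/
theorem sum_estCoef_mul_conj_estCoef (hS : S.Admissible) (ht : S.IsPilotIndex t) (m : Fin M)
    (j : Fin K) :
    ∑ i, S.estCoef t m j i * conj (S.estCoef t m j i) * S.antennaVar m i = S.γ m j := by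
  have hsq : (√(τ * S.ρp) : ℂ) * √(τ * S.ρp) = ((τ * S.ρp : ℝ) : ℂ) := by
    rw [← Complex.ofReal_mul, Real.mul_self_sqrt (mul_nonneg τ.cast_nonneg hS.ρp_nonneg)]
  have hγ : (S.γ m j : ℂ) = S.c m j * S.pilotPower t m j * S.c m j := by
    rw [γ, ← hS.c_mul_pilotPower ht]; push_cast; ring
  rw [hγ, Fintype.sum_sum_type]
  simp only [estCoef, antennaVar, Sum.elim_inl, Sum.elim_inr, pilotPower]
  have e : ∀ i, (if t i = t j then (√(τ * S.ρp) : ℂ) * S.c m j else 0) *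
      conj (if t i = t j then (√(τ * S.ρp) : ℂ) * S.c m j else 0) * S.β m i =
      ((τ * S.ρp : ℝ) : ℂ) * S.c m j ^ 2 * ((if t i = t j then S.β m i else 0 : ℝ) : ℂ) :=
    fun i => by
      rw [← hsq]
      split_ifs with h
      · simp only [map_mul, Complex.conj_ofReal]; ring
      · simp
  have e' : ∀ s, (S.c m j : ℂ) * S.φ (t j) s * conj ((S.c m j : ℂ) * S.φ (t j) s) * (1 : ℝ) =
      (S.c m j : ℂ) ^ 2 * (conj (S.φ (t j) s) * S.φ (t j) s) := fun s => by
    simp only [map_mul, Complex.conj_ofReal, Complex.ofReal_one]; ring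
  simp_rw [e, e', ← Finset.mul_sum, hS.sum_conj_pilot_mul]
  push_cast
  ring

/-- The random coefficient of the symbol of user `j` in the signal received by user `k`. -/
noncomputable def crossGain (S : CellFree M K L τ) (Z : CellFreeRV M K L τ Ω) (k j : Fin K)
    (ω : Ω) : ℂ :=
  (√S.ρd : ℂ) * ∑ m, (√(S.η m j) : ℂ) * ∑ l, conj (Z.g m k l ω) * S.estimate Z m j l ω

theorem received_eq (S : CellFree M K L τ) (Z : CellFreeRV M K L τ Ω) (k : Fin K)
    (x : Fin K → ℂ) (ω : Ω) :
    S.received Z k x ω = ∑ j, S.crossGain Z k j ω * x j + Z.w k ω := by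
  unfold received transmit crossGain
  congr 1
  simp_rw [Finset.mul_sum, Finset.sum_mul]
  have e : ∀ m : Fin M, ∑ l, ∑ j, conj (Z.g m k l ω) *
      ((√S.ρd : ℂ) * ((√(S.η m j) : ℂ) * S.estimate Z m j l ω * x j)) =
      ∑ j, ∑ l, conj (Z.g m k l ω) *
      ((√S.ρd : ℂ) * ((√(S.η m j) : ℂ) * S.estimate Z m j l ω * x j)) :=
    fun m => Finset.sum_comm
  simp_rw [e]
  rw [Finset.sum_comm]
  refine Finset.sum_congr rfl fun j _ => Finset.sum_congr rfl fun m _ =>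
    Finset.sum_congr rfl fun l _ => ?_
  ring

theorem userChannel_eq (S : CellFree M K L τ) (Z : CellFreeRV M K L τ Ω) (k : Fin K)
    (x : ℂ) (ω : Ω) :
    S.userChannel Z k x ω = S.gain Z k ω * x +
      (∑ j ∈ Finset.univ.erase k, S.crossGain Z k j ω * Z.q j ω + Z.w k ω) := by
  rw [userChannel, received_eq, ← Finset.add_sum_erase _ _ (Finset.mem_univ k), add_assoc,
    Function.update_self]
  congr 2
  refine Finset.sum_congr rfl fun j hj => ?_
  rw [Function.update_of_ne (Finset.ne_of_mem_erase hj)]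

theorem effNoise_eq [MeasurableSpace Ω] (S : CellFree M K L τ) (P : Measure Ω)
    (Z : CellFreeRV M K L τ Ω) (k : Fin K) (ω : Ω) :
    S.effNoise P Z k ω = (S.gain Z k ω - ∫ ω', S.gain Z k ω' ∂P) * Z.q k ω +
      (∑ j ∈ Finset.univ.erase k, S.crossGain Z k j ω * Z.q j ω + Z.w k ω) := by
  rw [effNoise, received_eq, ← Finset.add_sum_erase _ _ (Finset.mem_univ k)]
  simp only [gain, crossGain]
  ring

end CellFree

/-! ### Conjugate beamforming along a Gaussian channel -/

section Beamforming

variable {Ω : Type*} [MeasurableSpace Ω] {P : Measure Ω} {G E : Ω → ℂ} {v : ℝ}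

theorem memLp_two_conj_mul {X Y : Ω → ℂ} (hX : MemLp X 4 P) (hY : MemLp Y 4 P) :
    MemLp (fun ω => conj (X ω) * Y ω) 2 P := by
  have : ENNReal.HolderTriple 4 4 2 := ⟨by
    rw [← ENNReal.toReal_eq_toReal_iff' (by simp) (by simp), ENNReal.toReal_add (by simp) (by simp)]
    norm_num⟩
  exact hY.mul' hX.conj_complex

/-- Second moment of `G* (κ G + E)` for a Gaussian `G` and a centred `E` independent of `G`. -/
theorem integral_norm_sq_conj_mul_of_indepFun [IsProbabilityMeasure P] (hv : 0 ≤ v)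
    (hGm : Measurable G) (hG : P.map G = complexGaussian v) (hE : MemLp E 4 P) (hE0 : ∫ ω, E ω ∂P = 0)
    (hGE : IndepFun G E P) (κ : ℂ) :
    ∫ ω, ‖conj (G ω) * (κ * G ω + E ω)‖ ^ 2 ∂P =
      ‖κ * v‖ ^ 2 + v * ∫ ω, ‖κ * G ω + E ω‖ ^ 2 ∂P := by
  have hG4 := memLp_four_of_map_complexGaussian hGm hG
  have hG2 : MemLp G 2 P := hG4.mono_exponent (by norm_num)
  have hE2 : MemLp E 2 P := hE.mono_exponent (by norm_num)
  have hGE' : IndepFun (fun ω => conj (G ω)) E P :=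
    hGE.comp Complex.continuous_conj.measurable measurable_id
  have hm3 : Measurable (fun z : ℂ => κ * (conj z * z) * z) :=
    (((Complex.continuous_conj.mul continuous_id).const_mul κ).mul continuous_id).measurable
  have ho1 : ∫ ω, κ * G ω * conj (E ω) ∂P = 0 := by
    simp_rw [mul_assoc]
    rw [integral_const_mul, hGE.integral_mul_conj hG2.1 hE2.1, hE0]; simp
  -- The cross term is a function of `G` times the conjugate of the centred, independent `E`.
  have ho2 : ∫ ω, conj (G ω) * (κ * G ω) * conj (conj (G ω) * E ω) ∂P = 0 := by
    have e : ∀ ω, conj (G ω) * (κ * G ω) * conj (conj (G ω) * E ω) =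
        (κ * (conj (G ω) * G ω) * G ω) * conj (E ω) := fun ω => by
      rw [map_mul, Complex.conj_conj]; ring
    simp_rw [e]
    have hi : IndepFun (fun ω => κ * (conj (G ω) * G ω) * G ω) E P := hGE.comp hm3 measurable_id
    rw [hi.integral_mul_conj (hm3.comp hGm).aestronglyMeasurable hE2.1, hE0]
    simp
  have e4 : ∀ ω, ‖conj (G ω) * (κ * G ω)‖ ^ 2 = ‖κ‖ ^ 2 * ‖G ω‖ ^ 4 := fun ω => by
    rw [norm_mul, norm_mul, RCLike.norm_conj]; ring
  have e5 : ∀ ω, ‖κ * G ω‖ ^ 2 = ‖κ‖ ^ 2 * ‖G ω‖ ^ 2 := fun ω => by rw [norm_mul]; ring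
  simp_rw [mul_add (conj _)]
  rw [integral_norm_sq_add_of_orthogonal (memLp_two_conj_mul hG4 (hG4.const_mul κ))
      (memLp_two_conj_mul hG4 hE) ho2,
    integral_norm_sq_add_of_orthogonal (hG2.const_mul κ) hE2 ho1,
    hGE'.integral_norm_sq_mul hG2.conj_complex hE2]
  -- The fourth moment `2 v²` supplies `‖κ‖² v²` twice: once as the squared mean, once as `v` times
  -- the power of `κ G`.
  simp_rw [e4, e5, RCLike.norm_conj]
  rw [integral_const_mul, integral_const_mul,
    integral_norm_pow_four_of_map_complexGaussian hv hGm hG,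
    integral_norm_sq_of_map_complexGaussian hv hGm hG, norm_mul, Complex.norm_real,
    Real.norm_of_nonneg hv]
  ring

end Beamforming

/-! ### Cell-free systems: independence -/

namespace CellFree

variable {M K L τ : ℕ} {Ω : Type*}

/-- The σ-algebra generated by the random quantities with index in `T`. -/
@[reducible]
noncomputable def generated (Z : CellFreeRV M K L τ Ω)
    (T : Set ((Fin M × Fin K × Fin L) ⊕ (Fin M × Fin L × Fin τ) ⊕ Fin K ⊕ Fin K)) :
    MeasurableSpace Ω :=
  ⨆ i ∈ T, MeasurableSpace.comap (allRV Z i) inferInstance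

theorem measurable_allRV_generated (Z : CellFreeRV M K L τ Ω)
    {T : Set ((Fin M × Fin K × Fin L) ⊕ (Fin M × Fin L × Fin τ) ⊕ Fin K ⊕ Fin K)}
    {i : (Fin M × Fin K × Fin L) ⊕ (Fin M × Fin L × Fin τ) ⊕ Fin K ⊕ Fin K} (hi : i ∈ T) :
    Measurable[generated Z T] (allRV Z i) :=
  Measurable.of_comap_le (le_iSup₂_of_le i hi le_rfl)

/-- Disjoint subfamilies of an independent family generate independent σ-algebras. Independence of
derived signals thus becomes a question of which indices they use. -/
theorem IsModel.indepFun_of_disjoint [MeasurableSpace Ω] {S : CellFree M K L τ} {P : Measure Ω}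
    {Z : CellFreeRV M K L τ Ω} (hZ : S.IsModel P Z)
    {T T' : Set ((Fin M × Fin K × Fin L) ⊕ (Fin M × Fin L × Fin τ) ⊕ Fin K ⊕ Fin K)}
    (hT : Disjoint T T') {α β : Type*} [MeasurableSpace α] [MeasurableSpace β]
    {X : Ω → α} {Y : Ω → β} (hX : Measurable[generated Z T] X)
    (hY : Measurable[generated Z T'] Y) : IndepFun X Y P := by
  have h := indep_iSup_of_disjoint (fun i => (hZ.measurable i).comap_le) hZ.indep.iIndep hT
  exact (IndepFun_iff_Indep _ _ _).2 (indep_of_indep_of_le_left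
    (indep_of_indep_of_le_right h hY.comap_le) hX.comap_le)

/-- The index of an element of `antennaRV` in `allRV`. -/
def antennaIndex (m : Fin M) (l : Fin L) :
    Fin K ⊕ Fin τ → (Fin M × Fin K × Fin L) ⊕ (Fin M × Fin L × Fin τ) ⊕ Fin K ⊕ Fin K :=
  Sum.elim (fun i => .inl (m, i, l)) (fun s => .inr (.inl (m, l, s)))

theorem allRV_antennaIndex (Z : CellFreeRV M K L τ Ω) (m : Fin M) (l : Fin L)
    (i : Fin K ⊕ Fin τ) : allRV Z (antennaIndex m l i) = antennaRV Z m l i := by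
  rcases i with i | s <;> rfl

theorem antennaIndex_inj {m m' : Fin M} {l l' : Fin L} {i i' : Fin K ⊕ Fin τ}
    (h : antennaIndex m l i = antennaIndex m' l' i') : m = m' ∧ l = l' ∧ i = i' := by
  rcases i with i | s <;> rcases i' with i' | s' <;> simp_all [antennaIndex]

/-- Presents a channel as a linear combination, so that the bilinear second-moment formula covers it
as well. -/
theorem sum_single_mul_antennaRV (Z : CellFreeRV M K L τ Ω) (m : Fin M) (k : Fin K) (l : Fin L)
    (ω : Ω) : ∑ i, (Pi.single (.inl k) 1 : Fin K ⊕ Fin τ → ℂ) i * antennaRV Z m l i ω =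
      Z.g m k l ω := by
  rw [Finset.sum_eq_single (.inl k) (fun i _ hi => by simp [hi]) (by simp)]
  simp [antennaRV]

/-! ### Measurability for an arbitrary σ-algebra, used for both the ambient and the generated ones.
-/

section Generated

variable {mΩ : MeasurableSpace Ω} {S : CellFree M K L τ} {t : Fin K → Fin τ}
  {Z : CellFreeRV M K L τ Ω}

theorem Admissible.measurable_estimate (hS : S.Admissible) (ht : S.IsPilotIndex t) {m : Fin M}
    {l : Fin L} (h : ∀ i, Measurable[mΩ] (antennaRV Z m l i)) (j : Fin K) :
    Measurable[mΩ] (S.estimate Z m j l) := by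
  rw [show S.estimate Z m j l = _ from funext (hS.estimate_eq ht Z m j l)]
  exact Finset.measurable_fun_sum _ fun i _ => (h i).const_mul _

theorem IsPilotIndex.measurable_pilotRx (ht : S.IsPilotIndex t) {m : Fin M}
    {l : Fin L} (h : ∀ i, Measurable[mΩ] (antennaRV Z m l i)) (s : Fin τ) :
    Measurable[mΩ] (S.pilotRx Z m l s) := by
  rw [show S.pilotRx Z m l s = _ from funext (ht.pilotRx_eq Z m l s)]
  exact Finset.measurable_fun_sum _ fun i _ => (h i).const_mul _

theorem Admissible.measurable_crossGain (hS : S.Admissible) (ht : S.IsPilotIndex t)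
    (h : ∀ m l i, Measurable[mΩ] (antennaRV Z m l i)) (k j : Fin K) :
    Measurable[mΩ] (S.crossGain Z k j) := by
  refine Measurable.const_mul (Finset.measurable_fun_sum _ fun m _ => Measurable.const_mul
    (Finset.measurable_fun_sum _ fun l _ => ?_) _) _
  exact (Complex.continuous_conj.measurable.comp (h m l (.inl k))).mul
    (hS.measurable_estimate ht (h m l) j)

theorem measurable_antennaRV_generated (m : Fin M) (l : Fin L) (i : Fin K ⊕ Fin τ)
    {T : Set ((Fin M × Fin K × Fin L) ⊕ (Fin M × Fin L × Fin τ) ⊕ Fin K ⊕ Fin K)}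
    (hi : antennaIndex m l i ∈ T) : Measurable[generated Z T] (antennaRV Z m l i) := by
  rw [← allRV_antennaIndex]
  exact measurable_allRV_generated Z hi

end Generated

/-! ### Cell-free systems: moments -/

section Moments

variable [MeasurableSpace Ω] {S : CellFree M K L τ} {P : Measure Ω}
  {Z : CellFreeRV M K L τ Ω} {t : Fin K → Fin τ}

theorem IsModel.measurable_antennaRV (hZ : S.IsModel P Z) (m : Fin M) (l : Fin L)
    (i : Fin K ⊕ Fin τ) : Measurable (antennaRV Z m l i) := by
  rw [← allRV_antennaIndex]
  exact hZ.measurable _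

theorem IsModel.map_antennaRV (hZ : S.IsModel P Z) (m : Fin M) (l : Fin L)
    (i : Fin K ⊕ Fin τ) : P.map (antennaRV Z m l i) = complexGaussian (S.antennaVar m i) := by
  rcases i with i | s
  · exact hZ.g_law m i l
  · exact hZ.W_law m l s

theorem Admissible.antennaVar_nonneg (hS : S.Admissible) (m : Fin M) (i : Fin K ⊕ Fin τ) :
    0 ≤ S.antennaVar m i := by
  rcases i with i | s
  · exact (hS.β_pos m i).le
  · exact zero_le_one

theorem IsModel.memLp_four_antennaRV (hZ : S.IsModel P Z) (m : Fin M) (l : Fin L)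
    (i : Fin K ⊕ Fin τ) : MemLp (antennaRV Z m l i) 4 P :=
  memLp_four_of_map_complexGaussian (hZ.measurable_antennaRV m l i) (hZ.map_antennaRV m l i)

theorem IsModel.integral_antennaRV (hZ : S.IsModel P Z) (m : Fin M) (l : Fin L)
    (i : Fin K ⊕ Fin τ) : ∫ ω, antennaRV Z m l i ω ∂P = 0 :=
  integral_of_map_complexGaussian (hZ.measurable_antennaRV m l i) (hZ.map_antennaRV m l i)

theorem IsModel.memLp_four_estimate (hZ : S.IsModel P Z) (hS : S.Admissible)
    (ht : S.IsPilotIndex t) (m : Fin M) (j : Fin K) (l : Fin L) :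
    MemLp (S.estimate Z m j l) 4 P := by
  rw [show S.estimate Z m j l = _ from funext (hS.estimate_eq ht Z m j l)]
  exact memLp_finsetSum _ fun i _ => (hZ.memLp_four_antennaRV m l i).const_mul _

theorem IsModel.memLp_conj_mul_estimate (hZ : S.IsModel P Z) (hS : S.Admissible)
    (ht : S.IsPilotIndex t) (m : Fin M) (k j : Fin K) (l : Fin L) :
    MemLp (fun ω => conj (Z.g m k l ω) * S.estimate Z m j l ω) 2 P :=
  memLp_two_conj_mul (hZ.memLp_four_antennaRV m l (.inl k)) (hZ.memLp_four_estimate hS ht m j l)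

variable [IsProbabilityMeasure P]

theorem IsModel.memLp_two_antennaRV (hZ : S.IsModel P Z) (m : Fin M) (l : Fin L)
    (i : Fin K ⊕ Fin τ) : MemLp (antennaRV Z m l i) 2 P :=
  (hZ.memLp_four_antennaRV m l i).mono_exponent (by norm_num)

theorem IsModel.integral_linearCombination_antennaRV (hZ : S.IsModel P Z) (m : Fin M) (l : Fin L)
    (s : Finset (Fin K ⊕ Fin τ)) (a : Fin K ⊕ Fin τ → ℂ) :
    ∫ ω, ∑ i ∈ s, a i * antennaRV Z m l i ω ∂P = 0 := by
  rw [integral_finsetSum _ fun i _ =>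
    ((hZ.memLp_two_antennaRV m l i).integrable (by norm_num)).const_mul (a i)]
  simp [integral_const_mul, hZ.integral_antennaRV]

theorem IsModel.integral_antennaRV_mul_conj (hZ : S.IsModel P Z) (hS : S.Admissible) (m : Fin M)
    (l : Fin L) (a b : Fin K ⊕ Fin τ → ℂ) :
    ∫ ω, (∑ i, a i * antennaRV Z m l i ω) * conj (∑ i, b i * antennaRV Z m l i ω) ∂P =
      ∑ i, a i * conj (b i) * S.antennaVar m i := by
  refine integral_linearCombination_mul_conj _ (hZ.memLp_two_antennaRV m l)
    (fun i => integral_norm_sq_of_map_complexGaussian (hS.antennaVar_nonneg m i)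
      (hZ.measurable_antennaRV m l i) (hZ.map_antennaRV m l i)) (fun i j hij => ?_) a b
  have hi : IndepFun (antennaRV Z m l i) (antennaRV Z m l j) P := by
    rw [← allRV_antennaIndex, ← allRV_antennaIndex]
    exact hZ.indep.indepFun fun h => hij (antennaIndex_inj h).2.2
  rw [hi.integral_mul_conj (hZ.memLp_two_antennaRV m l i).1 (hZ.memLp_two_antennaRV m l j).1,
    hZ.integral_antennaRV, zero_mul]

theorem IsModel.memLp_two_estimate (hZ : S.IsModel P Z) (hS : S.Admissible)
    (ht : S.IsPilotIndex t) (m : Fin M) (j : Fin K) (l : Fin L) :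
    MemLp (S.estimate Z m j l) 2 P :=
  (hZ.memLp_four_estimate hS ht m j l).mono_exponent (by norm_num)

theorem IsModel.integral_norm_sq_estimate (hZ : S.IsModel P Z) (hS : S.Admissible)
    (ht : S.IsPilotIndex t) (m : Fin M) (j : Fin K) (l : Fin L) :
    ∫ ω, ‖S.estimate Z m j l ω‖ ^ 2 ∂P = S.γ m j := by
  apply Complex.ofReal_injective
  rw [← integral_mul_conj_self, ← sum_estCoef_mul_conj_estCoef hS ht,
    ← hZ.integral_antennaRV_mul_conj hS m l]
  simp_rw [hS.estimate_eq ht]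

theorem IsModel.isLMMSE_estimate (hZ : S.IsModel P Z) (hS : S.Admissible)
    (ht : S.IsPilotIndex t) (m : Fin M) (j : Fin K) (l : Fin L) :
    IsLMMSE P (Z.g m j l) (fun (i : Fin L × Fin τ) ω => S.pilotRx Z m i.1 i.2 ω)
      (S.estimate Z m j l) := by
  have hrx : ∀ l s, MemLp (S.pilotRx Z m l s) 2 P := fun l s => by
    rw [show S.pilotRx Z m l s = _ from funext (ht.pilotRx_eq Z m l s)]
    exact memLp_finsetSum _ fun i _ => (hZ.memLp_two_antennaRV m l i).const_mul _
  refine isLMMSE_of_orthogonal (hZ.memLp_two_antennaRV m l (.inl j)) (fun i => hrx i.1 i.2)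
    -- The estimate at antenna `l` gives zero weight to the observations at the other antennas.
    ⟨fun i => if i.1 = l then S.c m j * S.φ (t j) i.2 else 0, fun ω => ?_⟩ ?_
  · rw [ht.estimate_eq_sum_pilotRx, Fintype.sum_prod_type, Finset.sum_eq_single l, Finset.mul_sum]
    · refine Finset.sum_congr rfl fun s _ => ?_
      simp only [if_true]
      ring
    · intro l' _ hl'
      simp [hl']
    · simp
  · rintro ⟨l', s⟩
    have e : ∀ ω, Z.g m j l ω - S.estimate Z m j l ω =
        ∑ i, ((Pi.single (.inl j) 1 : Fin K ⊕ Fin τ → ℂ) i - S.estCoef t m j i) *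
          antennaRV Z m l i ω := fun ω => by
      simp_rw [sub_mul, Finset.sum_sub_distrib, ← hS.estimate_eq ht, sum_single_mul_antennaRV]
    -- At the same antenna orthogonality is the normal equation. At different antennas error and
    -- observation are independent and the error is centred.
    by_cases hl : l' = l
    · subst hl
      simp_rw [e, ht.pilotRx_eq]
      rw [hZ.integral_antennaRV_mul_conj hS]
      simp_rw [sub_mul, Finset.sum_sub_distrib]
      rw [sum_estCoef_mul_conj_rxCoef hS ht,
        Finset.sum_eq_single (.inl j) (fun i _ hi => by simp [hi]) (by simp)]
      simp only [Pi.single_eq_same, rxCoef, antennaVar, Sum.elim_inl, map_mul,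
        Complex.conj_ofReal, Complex.conj_conj]
      ring
    · have hi : IndepFun (fun ω => Z.g m j l ω - S.estimate Z m j l ω) (S.pilotRx Z m l' s) P := by
        refine hZ.indepFun_of_disjoint (T := Set.range (antennaIndex m l))
          (T' := Set.range (antennaIndex m l')) ?_ ?_ ?_
        · rw [Set.disjoint_left]
          rintro _ ⟨i, rfl⟩ ⟨i', h⟩
          exact hl (antennaIndex_inj h).2.1
        · have h : ∀ i, Measurable[generated Z (Set.range (antennaIndex m l))]
              (antennaRV Z m l i) := fun i => measurable_antennaRV_generated m l i ⟨i, rfl⟩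
          exact Measurable.sub (h (.inl j)) (hS.measurable_estimate ht h j)
        · exact ht.measurable_pilotRx
            (fun i => measurable_antennaRV_generated m l' i (Set.mem_range_self i)) s
      have hmeas : Measurable (fun ω => Z.g m j l ω - S.estimate Z m j l ω) :=
        (hZ.measurable_antennaRV m l (.inl j)).sub
          (hS.measurable_estimate ht (hZ.measurable_antennaRV m l) j)
      rw [hi.integral_mul_conj hmeas.aestronglyMeasurable (hrx l' s).1]
      simp_rw [e]
      rw [hZ.integral_linearCombination_antennaRV, zero_mul]

theorem IsModel.integral_conj_mul_estimate (hZ : S.IsModel P Z) (hS : S.Admissible)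
    (ht : S.IsPilotIndex t) (m : Fin M) (k j : Fin K) (l : Fin L) :
    ∫ ω, conj (Z.g m k l ω) * S.estimate Z m j l ω ∂P = S.estCoef t m j (.inl k) * S.β m k := by
  have h := hZ.integral_antennaRV_mul_conj hS m l (S.estCoef t m j) (Pi.single (.inl k) 1)
  simp_rw [sum_single_mul_antennaRV, ← hS.estimate_eq ht] at h
  simp_rw [mul_comm (conj _)]
  rw [h, Finset.sum_eq_single (.inl k) (fun i _ hi => by simp [hi]) (by simp)]
  simp [antennaVar]

theorem IsModel.integral_norm_sq_conj_mul_estimate (hZ : S.IsModel P Z) (hS : S.Admissible)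
    (ht : S.IsPilotIndex t) (m : Fin M) (k j : Fin K) (l : Fin L) :
    ∫ ω, ‖conj (Z.g m k l ω) * S.estimate Z m j l ω‖ ^ 2 ∂P =
      ‖S.estCoef t m j (.inl k) * S.β m k‖ ^ 2 + S.β m k * S.γ m j := by
  -- The part of the estimate that does not involve the channel of user `k` at this antenna.
  let E : Ω → ℂ := fun ω => ∑ i ∈ Finset.univ.erase (Sum.inl k),
    S.estCoef t m j i * antennaRV Z m l i ω
  have e : ∀ ω, S.estimate Z m j l ω = S.estCoef t m j (.inl k) * Z.g m k l ω + E ω := fun ω => by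
    rw [hS.estimate_eq ht, ← Finset.add_sum_erase _ _ (Finset.mem_univ (Sum.inl k))]
    rfl
  have hE : MemLp E 4 P :=
    memLp_finsetSum _ fun i _ => (hZ.memLp_four_antennaRV m l i).const_mul _
  have hGE : IndepFun (Z.g m k l) E P := by
    refine hZ.indepFun_of_disjoint (T := {antennaIndex m l (.inl k)})
      (T' := {antennaIndex m l (.inl k)}ᶜ) disjoint_compl_right ?_ ?_
    · exact measurable_antennaRV_generated m l (.inl k) rfl
    · refine Finset.measurable_fun_sum _ fun i hi => Measurable.const_mul
        (measurable_antennaRV_generated m l i fun h => ?_) _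
      exact Finset.ne_of_mem_erase hi (antennaIndex_inj h).2.2
  rw [← hZ.integral_norm_sq_estimate hS ht m j l]
  simp_rw [e]
  exact integral_norm_sq_conj_mul_of_indepFun (hS.β_pos m k).le
    (hZ.measurable_antennaRV m l (.inl k)) (hZ.g_law m k l) hE
    (hZ.integral_linearCombination_antennaRV m l _ _) hGE _

end Moments

end CellFree

namespace CellFree

variable {M K L τ : ℕ} {Ω : Type*}

/-! ### Cell-free systems: gains and effective noise -/

section Gains

variable {S : CellFree M K L τ} {Z : CellFreeRV M K L τ Ω} {t : Fin K → Fin τ}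

/-- The ratio `β_mk / β_mj` arises because `γ_mj` carries the fading of `j`, whereas the correlation
is with the channel of `k`. -/
theorem Admissible.estCoef_mul_eq (hS : S.Admissible) (t : Fin K → Fin τ) (m : Fin M)
    (k j : Fin K) : S.estCoef t m j (.inl k) * S.β m k =
      ((if t j = t k then S.γ m j * (S.β m k / S.β m j) else 0 : ℝ) : ℂ) := by
  have hβ := (hS.β_pos m j).ne'
  simp only [estCoef, Sum.elim_inl, eq_comm (a := t k)]
  split_ifs
  · rw [← Complex.ofReal_mul, ← Complex.ofReal_mul, γ]
    congr 1
    field_simp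
  · simp

theorem crossGain_eq_sum (S : CellFree M K L τ) (Z : CellFreeRV M K L τ Ω) (k j : Fin K)
    (ω : Ω) : S.crossGain Z k j ω = ∑ i : Fin M × Fin L,
      ((√S.ρd * √(S.η i.1 j) : ℝ) : ℂ) * (conj (Z.g i.1 k i.2 ω) * S.estimate Z i.1 j i.2 ω) := by
  rw [Fintype.sum_prod_type, crossGain]
  simp_rw [Finset.mul_sum]
  refine Finset.sum_congr rfl fun m _ => Finset.sum_congr rfl fun l _ => ?_
  push_cast
  ring

theorem Admissible.measurable_crossGain_generated (hS : S.Admissible) (ht : S.IsPilotIndex t)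
    (Z : CellFreeRV M K L τ Ω) (k j : Fin K) :
    Measurable[generated Z (Set.range Sum.inl ∪ Set.range (Sum.inr ∘ Sum.inl))]
      (S.crossGain Z k j) := by
  refine hS.measurable_crossGain ht (fun m l i => measurable_antennaRV_generated m l i ?_) k j
  rcases i with i | s
  · exact Or.inl ⟨_, rfl⟩
  · exact Or.inr ⟨_, rfl⟩

variable [MeasurableSpace Ω] {P : Measure Ω}

theorem IsModel.memLp_crossGain (hZ : S.IsModel P Z) (hS : S.Admissible)
    (ht : S.IsPilotIndex t) (k j : Fin K) : MemLp (S.crossGain Z k j) 2 P := by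
  rw [show S.crossGain Z k j = _ from funext (crossGain_eq_sum S Z k j)]
  exact memLp_finsetSum _ fun i _ => (hZ.memLp_conj_mul_estimate hS ht i.1 k j i.2).const_mul _

theorem IsModel.measurable_crossGain (hZ : S.IsModel P Z) (hS : S.Admissible)
    (ht : S.IsPilotIndex t) (k j : Fin K) : Measurable (S.crossGain Z k j) :=
  hS.measurable_crossGain ht (fun m l i => hZ.measurable_antennaRV m l i) k j

theorem IsModel.memLp_q (hZ : S.IsModel P Z) (k : Fin K) : MemLp (Z.q k) 2 P := by
  have hm : Measurable (Z.q k) := hZ.measurable (.inr (.inr (.inl k)))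
  rw [memLp_two_iff_integrable_sq_norm hm.aestronglyMeasurable]
  -- The integral of a non-integrable function is `0` by convention, which contradicts unit power.
  by_contra h
  exact zero_ne_one ((integral_undef h).symm.trans (hZ.q_power k))

variable [IsProbabilityMeasure P]

theorem IsModel.memLp_w (hZ : S.IsModel P Z) (k : Fin K) : MemLp (Z.w k) 2 P :=
  (memLp_four_of_map_complexGaussian (hZ.measurable (.inr (.inr (.inr k))))
    (hZ.w_law k)).mono_exponent (by norm_num)

theorem IsModel.integral_crossGain (hZ : S.IsModel P Z) (hS : S.Admissible)
    (ht : S.IsPilotIndex t) (k j : Fin K) :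
    ∫ ω, S.crossGain Z k j ω ∂P = ((√S.ρd * L * ∑ m, √(S.η m j) *
      (if t j = t k then S.γ m j * (S.β m k / S.β m j) else 0) : ℝ) : ℂ) := by
  simp_rw [crossGain_eq_sum]
  rw [integral_finsetSum _ fun i _ =>
    ((hZ.memLp_conj_mul_estimate hS ht i.1 k j i.2).integrable (by norm_num)).const_mul _]
  simp_rw [integral_const_mul, hZ.integral_conj_mul_estimate hS ht, hS.estCoef_mul_eq]
  rw [Fintype.sum_prod_type]
  simp only [Finset.sum_const, Finset.card_univ, Fintype.card_fin, nsmul_eq_mul, Finset.mul_sum,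
    Complex.ofReal_sum]
  refine Finset.sum_congr rfl fun m _ => ?_
  push_cast
  ring

/-- Terms at distinct antennas are independent, and each has variance `ρd η_mj γ_mj β_mk`, whether
or not the two users share a pilot. -/
theorem IsModel.integral_norm_sq_crossGain (hZ : S.IsModel P Z) (hS : S.Admissible)
    (ht : S.IsPilotIndex t) (k j : Fin K) :
    ∫ ω, ‖S.crossGain Z k j ω‖ ^ 2 ∂P = ‖∫ ω, S.crossGain Z k j ω ∂P‖ ^ 2 +
      S.ρd * L * ∑ m, S.η m j * S.γ m j * S.β m k := by
  have hmem : ∀ i ∈ (Finset.univ : Finset (Fin M × Fin L)), MemLp (fun ω =>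
      ((√S.ρd * √(S.η i.1 j) : ℝ) : ℂ) * (conj (Z.g i.1 k i.2 ω) * S.estimate Z i.1 j i.2 ω)) 2 P :=
    fun i _ => (hZ.memLp_conj_mul_estimate hS ht i.1 k j i.2).const_mul _
  simp_rw [crossGain_eq_sum]
  rw [integral_finsetSum _ fun i hi => (hmem i hi).integrable (by norm_num),
    integral_norm_sq_sum_of_indepFun _ hmem]
  · congr 1
    simp_rw [norm_mul (Complex.ofReal _), mul_pow, integral_const_mul, norm_mul (Complex.ofReal _),
      mul_pow, hZ.integral_norm_sq_conj_mul_estimate hS ht, hZ.integral_conj_mul_estimate hS ht,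
      ← mul_sub, add_sub_cancel_left, Complex.norm_real, Real.norm_eq_abs, sq_abs, mul_pow,
      Real.sq_sqrt hS.ρd_nonneg, Real.sq_sqrt (hS.η_nonneg _ _)]
    rw [Fintype.sum_prod_type]
    simp only [Finset.sum_const, Finset.card_univ, Fintype.card_fin, nsmul_eq_mul, Finset.mul_sum]
    refine Finset.sum_congr rfl fun m _ => ?_
    ring
  · rintro ⟨m, l⟩ - ⟨m', l'⟩ - hne
    have hmeas : ∀ (m : Fin M) (l : Fin L),
        Measurable[generated Z (Set.range (antennaIndex m l))] (fun ω =>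
          ((√S.ρd * √(S.η m j) : ℝ) : ℂ) * (conj (Z.g m k l ω) * S.estimate Z m j l ω)) := by
      intro m l
      have h : ∀ i, Measurable[generated Z (Set.range (antennaIndex m l))] (antennaRV Z m l i) :=
        fun i => measurable_antennaRV_generated m l i ⟨i, rfl⟩
      exact Measurable.const_mul (Measurable.mul
        (Complex.continuous_conj.measurable.comp (h (.inl k)))
        (hS.measurable_estimate ht h j)) _
    refine hZ.indepFun_of_disjoint ?_ (hmeas m l) (hmeas m' l')
    rw [Set.disjoint_left]
    rintro _ ⟨i, rfl⟩ ⟨i', h⟩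
    have := antennaIndex_inj h
    exact hne (by rw [this.1, this.2.1])

/-- Second moment of a superposition of the data symbols with coefficients that depend on the
channels and the pilot-phase noise only. -/
theorem IsModel.superposition (hZ : S.IsModel P Z) (k : Fin K) {b : Fin K → Ω → ℂ}
    (hbm : ∀ j, Measurable[generated Z (Set.range Sum.inl ∪ Set.range (Sum.inr ∘ Sum.inl))] (b j))
    (hb : ∀ j, MemLp (b j) 2 P) (s : Finset (Fin K)) :
    MemLp (fun ω => ∑ j ∈ s, b j ω * Z.q j ω + Z.w k ω) 2 P ∧
      ∫ ω, ‖∑ j ∈ s, b j ω * Z.q j ω + Z.w k ω‖ ^ 2 ∂P = ∑ j ∈ s, ∫ ω, ‖b j ω‖ ^ 2 ∂P + 1 := by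
  induction s using Finset.induction_on with
  | empty =>
    simp only [Finset.sum_empty, zero_add]
    exact ⟨hZ.memLp_w k, integral_norm_sq_of_map_complexGaussian zero_le_one
      (hZ.measurable (.inr (.inr (.inr k)))) (hZ.w_law k)⟩
  | insert j s hj ih =>
    simp_rw [Finset.sum_insert hj, add_assoc]
    have hle : generated Z (Set.range Sum.inl ∪ Set.range (Sum.inr ∘ Sum.inl)) ≤
        generated Z {.inr (.inr (.inl j))}ᶜ := by
      refine biSup_mono fun i hi => ?_
      rcases hi with ⟨i, rfl⟩ | ⟨i, rfl⟩ <;> simp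
    -- The new symbol is the input of an affine channel with gain `b j`. The remaining superposition
    -- is the noise, and neither involves `q j`.
    have hi : IndepFun (Z.q j) (fun ω => (b j ω, ∑ i ∈ s, b i ω * Z.q i ω + Z.w k ω)) P := by
      refine hZ.indepFun_of_disjoint (T := {.inr (.inr (.inl j))})
        (T' := {.inr (.inr (.inl j))}ᶜ) disjoint_compl_right
        (measurable_allRV_generated Z (i := .inr (.inr (.inl j))) rfl) ?_
      refine Measurable.prodMk ((hbm j).mono hle le_rfl) (Measurable.add
        (Finset.measurable_fun_sum _ fun i his => Measurable.mul ((hbm i).mono hle le_rfl) ?_) ?_)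
      · exact measurable_allRV_generated Z (i := .inr (.inr (.inl i)))
          (by simpa using fun h : i = j => hj (h ▸ his))
      · exact measurable_allRV_generated Z (i := .inr (.inr (.inr k))) (by simp)
    refine ⟨memLp_mul_add_of_indepFun hi (hZ.memLp_q j) (hb j) ih.1, ?_⟩
    rw [integral_norm_sq_mul_add_of_indepFun hi (hZ.memLp_q j) (hb j) ih.1 (hZ.q_mean j)
      (hZ.q_power j), ih.2]

theorem IsModel.memLp_effNoise (hZ : S.IsModel P Z) (hS : S.Admissible) (ht : S.IsPilotIndex t)
    (k : Fin K) : MemLp (S.effNoise P Z k) 2 P ∧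
      ∫ ω, ‖S.effNoise P Z k ω‖ ^ 2 ∂P =
        ∫ ω, ‖S.gain Z k ω‖ ^ 2 ∂P - ‖∫ ω, S.gain Z k ω ∂P‖ ^ 2 +
          (∑ j ∈ Finset.univ.erase k, ∫ ω, ‖S.crossGain Z k j ω‖ ^ 2 ∂P + 1) := by
  -- Subtracting the mean gain only centres the coefficient of `q k`, so the effective noise is
  -- again a superposition.
  let b : Fin K → Ω → ℂ := fun j ω =>
    S.crossGain Z k j ω - if j = k then ∫ ω', S.gain Z k ω' ∂P else 0
  have h := hZ.superposition k (b := b)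
    (fun j => Measurable.sub_const (hS.measurable_crossGain_generated ht Z k j) _)
    (fun j => (hZ.memLp_crossGain hS ht k j).sub (memLp_const _)) Finset.univ
  have e : ∀ ω, ∑ j, b j ω * Z.q j ω + Z.w k ω = S.effNoise P Z k ω := fun ω => by
    rw [effNoise_eq, ← Finset.add_sum_erase _ _ (Finset.mem_univ k), add_assoc]
    congr 2
    · simp [b, gain, crossGain]
    · refine Finset.sum_congr rfl fun j hj => ?_
      simp [b, Finset.ne_of_mem_erase hj]
  simp_rw [e] at h
  refine ⟨h.1, h.2.trans ?_⟩
  rw [← Finset.add_sum_erase _ _ (Finset.mem_univ k), add_assoc,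
    ← integral_norm_sub_integral_sq (X := S.gain Z k) (hZ.memLp_crossGain hS ht k k)]
  congr 2
  · simp [b, gain, crossGain]
  · refine Finset.sum_congr rfl fun j hj => ?_
    simp [b, Finset.ne_of_mem_erase hj]

theorem IsModel.norm_sq_integral_gain (hZ : S.IsModel P Z) (hS : S.Admissible)
    (ht : S.IsPilotIndex t) (k : Fin K) :
    ‖∫ ω, S.gain Z k ω ∂P‖ ^ 2 = S.ρd * (L : ℝ) ^ 2 * (∑ m, √(S.η m k) * S.γ m k) ^ 2 := by
  have h := hZ.integral_crossGain hS ht k k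
  have e : ∀ m, S.β m k / S.β m k = 1 := fun m => div_self (hS.β_pos m k).ne'
  simp only [if_true, e, mul_one] at h
  rw [show S.gain Z k = S.crossGain Z k k from rfl, h, Complex.norm_real, Real.norm_eq_abs, sq_abs,
    mul_pow, mul_pow, Real.sq_sqrt hS.ρd_nonneg]

theorem IsModel.integral_norm_sq_effNoise (hZ : S.IsModel P Z) (hS : S.Admissible)
    (ht : S.IsPilotIndex t) (k : Fin K) :
    ∫ ω, ‖S.effNoise P Z k ω‖ ^ 2 ∂P =
      S.ρd * (L : ℝ) ^ 2 * ∑ j ∈ Finset.univ.erase k,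
          (∑ m, √(S.η m j) * S.γ m j * (S.β m k / S.β m j)) ^ 2 *
            ‖∑ t, ∑ t', (S.p j t : ℂ) * (S.p k t' : ℂ) * inner ℂ (S.φ t) (S.φ t')‖
        + S.ρd * L * ∑ j, ∑ m, S.η m j * S.γ m j * S.β m k + 1 := by
  have hj : ∀ j, ∫ ω, ‖S.crossGain Z k j ω‖ ^ 2 ∂P = S.ρd * (L : ℝ) ^ 2 *
      ((∑ m, √(S.η m j) * S.γ m j * (S.β m k / S.β m j)) ^ 2 *
        (if t j = t k then 1 else 0)) + S.ρd * L * ∑ m, S.η m j * S.γ m j * S.β m k := by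
    intro j
    rw [hZ.integral_norm_sq_crossGain hS ht, hZ.integral_crossGain hS ht, Complex.norm_real,
      Real.norm_eq_abs, sq_abs, mul_pow, mul_pow, Real.sq_sqrt hS.ρd_nonneg]
    split_ifs
    · simp_rw [mul_assoc, mul_one]
    · simp
  -- The own gain loses its squared mean and keeps its variance. Hence `j = k` is absent from the
  -- coherent sum and present in the incoherent one.
  rw [(hZ.memLp_effNoise hS ht k).2, show S.gain Z k = S.crossGain Z k k from rfl,
    hZ.integral_norm_sq_crossGain hS ht k k, add_sub_cancel_left]
  simp_rw [hj, hS.norm_sum_inner_pilot ht]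
  rw [Finset.sum_add_distrib, ← Finset.mul_sum, ← Finset.mul_sum,
    ← Finset.add_sum_erase Finset.univ (fun j => ∑ m, S.η m j * S.γ m j * S.β m k)
      (Finset.mem_univ k)]
  ring

/-- The receiver noise alone contributes `1`; the other contributions are nonnegative. -/
theorem IsModel.integral_norm_sq_effNoise_pos (hZ : S.IsModel P Z) (hS : S.Admissible)
    (ht : S.IsPilotIndex t) (k : Fin K) : 0 < ∫ ω, ‖S.effNoise P Z k ω‖ ^ 2 ∂P := by
  have h0 : 0 ≤ ∑ j ∈ Finset.univ.erase k, ∫ ω, ‖S.crossGain Z k j ω‖ ^ 2 ∂P :=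
    Finset.sum_nonneg fun j _ => integral_nonneg fun ω => by positivity
  have h1 : 0 ≤ ∫ ω, ‖S.gain Z k ω - ∫ ω', S.gain Z k ω' ∂P‖ ^ 2 ∂P :=
    integral_nonneg fun ω => by positivity
  rw [integral_norm_sub_integral_sq (X := S.gain Z k) (hZ.memLp_crossGain hS ht k k)] at h1
  rw [(hZ.memLp_effNoise hS ht k).2]
  linarith

theorem IsModel.ergodicThroughput_eq (hZ : S.IsModel P Z) (hS : S.Admissible)
    (ht : S.IsPilotIndex t) (k : Fin K) : S.ergodicThroughput P Z k = S.downlinkRate k := by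
  rw [ergodicThroughput, downlinkRate, hZ.norm_sq_integral_gain hS ht,
    hZ.integral_norm_sq_effNoise hS ht]

theorem IsModel.ofReal_ergodicThroughput_le (hZ : S.IsModel P Z) (hS : S.Admissible)
    (ht : S.IsPilotIndex t) (k : Fin K) :
    ENNReal.ofReal (S.ergodicThroughput P Z k) ≤
      ENNReal.ofReal S.B * channelCapacity P (S.userChannel Z k) := by
  rw [ergodicThroughput, ENNReal.ofReal_mul hS.B_nonneg]
  gcongr
  let N : Ω → ℂ := fun ω =>
    ∑ j ∈ Finset.univ.erase k, S.crossGain Z k j ω * Z.q j ω + Z.w k ω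
  have hN := hZ.superposition k (hS.measurable_crossGain_generated ht Z k)
    (hZ.memLp_crossGain hS ht k) (Finset.univ.erase k)
  have hNm : Measurable N := (Finset.measurable_fun_sum _ fun j _ =>
    (hZ.measurable_crossGain hS ht k j).mul (hZ.measurable (.inr (.inr (.inl j))))).add
      (hZ.measurable (.inr (.inr (.inr k))))
  rw [show S.userChannel Z k = fun x ω => S.gain Z k ω * x + N ω from
    funext fun x => funext fun ω => userChannel_eq S Z k x ω]
  refine ofReal_logb_le_channelCapacity (hZ.measurable_crossGain hS ht k k) hNm
    (hZ.memLp_crossGain hS ht k k) hN.1 (hZ.integral_norm_sq_effNoise_pos hS ht k) ?_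
  -- The effective noise power is the variance of the gain plus the power of `N`, which is the
  -- identity required of `V`.
  rw [hN.2, (hZ.memLp_effNoise hS ht k).2]
  simp only [show S.gain Z k = S.crossGain Z k k from rfl]
  ring

end Gains

end CellFree

theorem lemma1 {M K L τ : ℕ} {Ω : Type*} [MeasurableSpace Ω]
    (P : Measure Ω) [IsProbabilityMeasure P]
    (S : CellFree M K L τ) (hS : S.Admissible)
    (Z : CellFreeRV M K L τ Ω) (hZ : S.IsModel P Z) (k : Fin K) :
    -- the channel estimates are the LMMSE estimates, with second moments `γ`
    (∀ m j l, IsLMMSE P (Z.g m j l)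
        (fun (i : Fin L × Fin τ) ω => S.pilotRx Z m i.1 i.2 ω) (S.estimate Z m j l)) ∧
    (∀ m j l, MemLp (S.estimate Z m j l) 2 P ∧
        ∫ ω, ‖S.estimate Z m j l ω‖ ^ 2 ∂P = S.γ m j) ∧
    -- the use-and-then-forget throughput is well defined and has the closed form
    Integrable (S.gain Z k) P ∧ MemLp (S.effNoise P Z k) 2 P ∧
    0 < ∫ ω, ‖S.effNoise P Z k ω‖ ^ 2 ∂P ∧
    S.ergodicThroughput P Z k = S.downlinkRate k ∧
    -- it is achievable: it does not exceed bandwidth times capacity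
    ENNReal.ofReal (S.downlinkRate k) ≤
      ENNReal.ofReal S.B * channelCapacity P (S.userChannel Z k) ∧
    -- it depends on the pilots only through their assignment
    (∀ φ' : Fin τ → EuclideanSpace ℂ (Fin τ), Orthonormal ℂ φ' →
      ({ S with φ := φ' } : CellFree M K L τ).downlinkRate k = S.downlinkRate k) := by
  obtain ⟨t, ht⟩ := hS.exists_isPilotIndex
  refine ⟨fun m j l => hZ.isLMMSE_estimate hS ht m j l, fun m j l =>
    ⟨hZ.memLp_two_estimate hS ht m j l, hZ.integral_norm_sq_estimate hS ht m j l⟩,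
    (hZ.memLp_crossGain hS ht k k).integrable (by norm_num), (hZ.memLp_effNoise hS ht k).1,
    hZ.integral_norm_sq_effNoise_pos hS ht k, hZ.ergodicThroughput_eq hS ht k, ?_,
    hS.downlinkRate_eq_of_orthonormal k⟩
  rw [← hZ.ergodicThroughput_eq hS ht k]
  exact hZ.ofReal_ergodicThroughput_le hS ht k
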